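/- For an integer $t\ge -1$ let $f_t(x)=x^3-tx^2-(t+3)x-1$ and $\Delta_t=t^2+3t+9$, let $\theta_t\in\mathbb C$ be a root of $f_t$, and let $K=K_t=\mathbb Q(\theta_t)$. Write $\zeta_n=e^{2\pi i/n}$, let $c_K$ be the conductor of $K$, that is, the least positive integer $m$ with $K\subseteq\mathbb Q(\zeta_m)$, and let $v_p$ denote the $p$-adic valuation. Assume that $K\ne\mathbb Q(\zeta_9+\zeta_9^{-1})$. Then there is exactly one integral ideal $\mathfrak C_K$ of $\mathcal O_K$ of absolute norm $c_K$, and the following conditions are equivalent. (i) $\mathfrak C_K$ is principal. (ii) Either $3\nmid c_K$ and one of the following two statements holds: $v_p(\Delta_t)\equiv 1 \bmod 3$ for all primes $p\mid c_K$, or $v_p(\Delta_t)\equiv 2\bmod 3$ for all primes $p\mid c_K$; or $3\mid c_K$, $v_3(\Delta_t)=2$, and $v_p(\Delta_t)\equiv 1\bmod 3$ for all primes $p\ne 3$ with $p\mid c_K$. (iii) Either ($3\nmid t$ or $t\equiv 12\bmod 27$) and one of the following two statements holds: $v_p(\Delta_t)\not\equiv 1\bmod 3$ for all primes $p$, or $v_p(\Delta_t)\not\equiv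 2\bmod 3$ for all primes $p$; or $t\equiv 0$ or $6\bmod 9$, and $v_p(\Delta_t)\not\equiv 2\bmod 3$ for all primes $p\neq 3$. In particular, if $t\equiv 3$ or $21\bmod 27$, none of the three conditions holds. -/

import Mathlib

noncomputable section

namespace SimplestCubic

/-- Shanks' cubic polynomial `f_t(x) = x³ - t x² - (t + 3) x - 1`. -/
def shanksPoly (t : ℤ) : Polynomial ℤ :=
  Polynomial.X ^ 3 - Polynomial.C t * Polynomial.X ^ 2
    - Polynomial.C (t + 3) * Polynomial.X - 1

/-- The integer `Δ_t = t² + 3t + 9`. -/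
def Delta (t : ℤ) : ℤ := t ^ 2 + 3 * t + 9

/-- `ζ_n = exp(2πi/n)`. -/
def zeta (n : ℕ) : ℂ := Complex.exp (2 * Real.pi * Complex.I / n)

/-- The conductor `c_K` of an abelian field `K ⊆ ℂ`: the least positive integer `m`
such that `K ⊆ ℚ(ζ_m)`. -/
def conductor (K : IntermediateField ℚ ℂ) : ℕ :=
  sInf {m : ℕ | 0 < m ∧ K ≤ IntermediateField.adjoin ℚ {zeta m}}

/-- The ideal `𝔆_K` of `𝓞 K`: the integral ideal whose absolute norm is the conductor of `K`.
(For cyclic cubic `K` there is exactly one such ideal.) -/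
def conductorIdeal (K : IntermediateField ℚ ℂ) [NumberField K] :
    Ideal (NumberField.RingOfIntegers K) :=
  Classical.epsilon fun I => Ideal.absNorm I = conductor K

end SimplestCubic

end

/-! Write `δ = t - 3ω` in `ℤ[ω]`, an element of norm `Δ_t`. Two cubic identities drive everything:
Cardano's formula expresses a root of `f_t` through a cube root of `δ² δ̄ = δ Δ_t`, and `(θ² + θ +
1)³` equals `Δ_t` times a unit of `𝓞 K`.

Conductor. The first identity turns membership of `θ` in a cyclotomic field into a cube condition on
`δ` (`root_mem_of_cube`). For a prime `p ≡ 1 mod 3`, the cubic Gauss sum satisfies `g³ = J² J̄`,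
with `J` a primary Jacobi sum of norm `p`; so `δ` can be treated prime by prime, up to a unit that
is `±1` or costs `ζ₉`. Hence `θ` lies in `ℚ(ζ_c)` with `c = explicitConductor t`. Conversely every
prime `p ∣ c` has `(p) = P³` in `𝓞 K`, and ramification in `ℚ(ζ_m)` then forces `c ∣ m`
(`explicitConductor_dvd`). The same cubes show that norm `c` means cube `(c)`, so the ideal `C` of
norm `c` exists and is unique.

Principality. If `c n³ = Δ_t ^ j`, then `(θ² + θ + 1)^j = C · (n)`, so `C` is principal
(`isPrincipal_of_mul_pow_three_eq`). For the converse (`exists_pow_three_eq_mul_Delta_pow`), let `C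
= (α)` and let `σ` generate the Galois group. Then `σα/α` is a unit, and the units modulo `±(σ - 1)`
form a group of order `3`, generated by `θ` because `Δ_t` is not a rational cube. Since `β = (θ² + θ
+ 1)/(1 + θ)` satisfies `σβ = β/θ`, correcting `α` by a power of `β` and a unit gives an element
that `σ` fixes up to sign, hence a rational number; cubing it shows that `c Δ_t ^ j` is a rational
cube. So `C` is principal exactly when `c Δ_t ^ j` is a cube for some `j`, and comparing valuations
gives the other two conditions. -/

open QuadraticAlgebra in
/-- The ring `ℤ[ω]` of Eisenstein integers, with `ω² = -1 - ω`. -/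
abbrev Eisenstein : Type := QuadraticAlgebra ℤ (-1) (-1)

/-! ### Eisenstein integers: division with remainder, units, primary elements. -/

namespace Eisenstein

open SimplestCubic QuadraticAlgebra

/-- The norm form `a² - ab + b²` of `ℤ[ω]`. -/
abbrev nm : Eisenstein →* ℤ := QuadraticAlgebra.norm

theorem norm_eq (x : Eisenstein) : nm x = x.re ^ 2 - x.re * x.im + x.im ^ 2 := by
  rw [norm_def]; ring

theorem norm_nonneg (x : Eisenstein) : 0 ≤ nm x := by
  rw [norm_eq]; nlinarith [sq_nonneg (x.re - x.im), sq_nonneg x.re, sq_nonneg x.im]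

theorem norm_eq_zero {x : Eisenstein} : nm x = 0 ↔ x = 0 := by
  refine ⟨fun h ↦ ?_, fun h ↦ by simp [h]⟩
  rw [norm_eq] at h
  have h1 : x.re ^ 2 = 0 := by
    nlinarith [sq_nonneg (x.re - x.im), sq_nonneg x.re, sq_nonneg x.im]
  have h2 : x.im ^ 2 = 0 := by
    nlinarith [sq_nonneg (x.re - x.im), sq_nonneg x.re, sq_nonneg x.im]
  ext
  · simpa using h1
  · simpa using h2

theorem norm_pos {x : Eisenstein} (hx : x ≠ 0) : 0 < nm x :=
  lt_of_le_of_ne (norm_nonneg x) fun h ↦ hx (norm_eq_zero.1 h.symm)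

theorem mul_star_eq (x : Eisenstein) : x * star x = (nm x : Eisenstein) := by
  rw [← algebraMap_norm_eq_mul_star]; rfl

/-- Division with remainder: round the coordinates of the exact quotient. -/
def quo (x y : Eisenstein) : Eisenstein :=
  ⟨round ((x * star y).re / nm y : ℚ), round ((x * star y).im / nm y : ℚ)⟩

/-- Rounding leaves coordinate errors `r`, `s` of size at most `1/2`, and then `r² - rs + s² ≤ 3/4`.
-/
theorem norm_sub_mul_quo_lt (x : Eisenstein) {y : Eisenstein} (hy : y ≠ 0) :
    nm (x - y * quo x y) < nm y := by
  have hn := norm_pos hy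
  have hnq : (0 : ℚ) < nm y := by exact_mod_cast hn
  set u := (x * star y).re with hu
  set v := (x * star y).im with hv
  have key : nm (x - y * quo x y) * nm y =
      (u - nm y * round (u / nm y : ℚ)) ^ 2 -
      (u - nm y * round (u / nm y : ℚ)) * (v - nm y * round (v / nm y : ℚ)) +
      (v - nm y * round (v / nm y : ℚ)) ^ 2 := by
    have h1 : nm (x - y * quo x y) * nm y = nm ((x - y * quo x y) * star y) := by
      rw [map_mul, nm, QuadraticAlgebra.norm_star]
    have h2 : (x - y * quo x y) * star y = x * star y - (nm y : Eisenstein) * quo x y := by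
      rw [← mul_star_eq, sub_mul]; congr 1; exact mul_right_comm _ _ _
    rw [h1, h2, norm_eq]
    have e1 : (x * star y - (nm y : Eisenstein) * quo x y).re =
        u - nm y * round (u / nm y : ℚ) := by
      rw [re_sub, ← hu]; congr 1; rw [re_mul]; simp [quo, ← hu]
    have e2 : (x * star y - (nm y : Eisenstein) * quo x y).im =
        v - nm y * round (v / nm y : ℚ) := by
      rw [im_sub, ← hv]; congr 1; rw [im_mul]; simp [quo, ← hv]
    rw [e1, e2]
  have h1 := abs_sub_round (u / nm y : ℚ)
  have h2 := abs_sub_round (v / nm y : ℚ)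
  set r := (u / nm y : ℚ) - round (u / nm y : ℚ) with hr
  set s := (v / nm y : ℚ) - round (v / nm y : ℚ) with hs
  have key2 : (nm (x - y * quo x y) : ℚ) = nm y * (r ^ 2 - r * s + s ^ 2) := by
    have hc := congrArg (Int.cast : ℤ → ℚ) key
    have er : (u : ℚ) - nm y * round (u / nm y : ℚ) = nm y * r := by
      rw [hr]; field_simp
    have es : (v : ℚ) - nm y * round (v / nm y : ℚ) = nm y * s := by
      rw [hs]; field_simp
    push_cast at hc
    rw [er, es] at hc
    apply mul_right_cancel₀ hnq.ne'
    rw [hc]; ring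
  have h3 : r ^ 2 - r * s + s ^ 2 < 1 := by
    rw [abs_le] at h1 h2
    nlinarith [sq_nonneg (r - s), sq_nonneg (r + s)]
  have : (nm (x - y * quo x y) : ℚ) < nm y := by
    rw [key2]; nlinarith
  exact_mod_cast this

instance : Nontrivial Eisenstein := ⟨⟨0, 1, fun h ↦ by simpa using congrArg re h⟩⟩

instance : EuclideanDomain Eisenstein :=
  { (inferInstance : CommRing Eisenstein), (inferInstance : Nontrivial Eisenstein) with
    quotient := quo
    remainder := fun x y ↦ x - y * quo x y
    quotient_zero := fun x ↦ by ext <;> simp [quo]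
    quotient_mul_add_remainder_eq := fun _ _ ↦ by ring
    r := _
    r_wellFounded := (measure fun x : Eisenstein ↦ (nm x).natAbs).wf
    remainder_lt := fun x y hy ↦ by
      have := norm_sub_mul_quo_lt x hy
      have h0 := norm_nonneg (x - y * quo x y)
      change (nm (x - y * quo x y)).natAbs < (nm y).natAbs
      omega
    mul_left_not_lt := fun x y hy ↦ by
      change ¬ (nm (x * y)).natAbs < (nm x).natAbs
      rw [map_mul, Int.natAbs_mul, not_lt]
      exact Nat.le_mul_of_pos_right _ (Int.natAbs_pos.2 (norm_pos hy).ne') }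

theorem isUnit_iff {x : Eisenstein} : IsUnit x ↔ nm x = 1 := by
  rw [isUnit_iff_norm_isUnit, Int.isUnit_iff]
  have := norm_nonneg x
  constructor
  · rintro (h | h)
    · exact h
    · exact absurd this (by rw [show nm x = -1 from h]; decide)
  · exact Or.inl

/-- An Eisenstein integer is primary if it is congruent to `±1` modulo `3`. -/
def Primary (x : Eisenstein) : Prop := 3 ∣ x.im ∧ ¬ 3 ∣ x.re

theorem Primary.mul {x y : Eisenstein} (hx : Primary x) (hy : Primary y) : Primary (x * y) := by
  obtain ⟨⟨a, ha⟩, hx⟩ := hx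
  obtain ⟨⟨b, hb⟩, hy⟩ := hy
  constructor
  · rw [im_mul, ha, hb]
    exact ⟨x.re * b + a * y.re - 3 * a * b, by ring⟩
  · rw [re_mul, ha, hb]
    intro h
    have h3 : (3 : ℤ) ∣ x.re * y.re := by
      have : x.re * y.re = (x.re * y.re + -1 * (3 * a) * (3 * b)) + 3 * (3 * a * b) := by ring
      rw [this]
      exact dvd_add h (dvd_mul_right _ _)
    exact (Int.prime_three.dvd_or_dvd h3).elim hx hy

theorem Primary.one : Primary 1 := by
  constructor <;> simp [QuadraticAlgebra.re_one, QuadraticAlgebra.im_one]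

theorem Primary.pow {x : Eisenstein} (hx : Primary x) (n : ℕ) : Primary (x ^ n) := by
  induction n with
  | zero => simpa using Primary.one
  | succ n ih => rw [pow_succ]; exact ih.mul hx

theorem Primary.star {x : Eisenstein} (hx : Primary x) : Primary (star x) := by
  obtain ⟨h1, h2⟩ := hx
  constructor
  · simpa using h1
  · simp only [re_star]; omega

theorem isUnit_omega : IsUnit (⟨0, 1⟩ : Eisenstein) := by
  rw [isUnit_iff, norm_eq]; norm_num

theorem not_three_dvd_norm {x : Eisenstein} :
    ¬ 3 ∣ nm x ↔ ¬ 3 ∣ x.re + x.im := by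
  have : nm x = (x.re + x.im) ^ 2 + 3 * (- x.re * x.im) := by rw [norm_eq]; ring
  rw [this, not_iff_not, ← Int.prime_three.dvd_pow_iff_dvd (a := x.re + x.im) two_ne_zero]
  exact Int.dvd_add_left (dvd_mul_right _ _)

/-- Norm prime to `3` leaves three lines of residues mod `3`: `im = 0`, `re = 0`, `re = im`.
Multiplication by a power of `ω` moves each of them to the first. -/
theorem exists_primary_associated {x : Eisenstein} (hx : ¬ 3 ∣ nm x) :
    ∃ y, Primary y ∧ Associated x y := by
  rw [not_three_dvd_norm] at hx
  have h : 3 ∣ x.im ∨ 3 ∣ x.re ∨ 3 ∣ x.re - x.im := by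
    have h1 : x.re % 3 = 0 ∨ x.re % 3 = 1 ∨ x.re % 3 = 2 := by omega
    have h2 : x.im % 3 = 0 ∨ x.im % 3 = 1 ∨ x.im % 3 = 2 := by omega
    rcases h1 with h1 | h1 | h1 <;> rcases h2 with h2 | h2 | h2 <;> omega
  rcases h with h | h | h
  · exact ⟨x, ⟨h, by omega⟩, Associated.refl _⟩
  · refine ⟨x * ⟨0, 1⟩ ^ 2, ?_, associated_mul_unit_right _ _ (isUnit_omega.pow 2)⟩
    constructor <;> simp [sq] <;> omega
  · refine ⟨x * ⟨0, 1⟩, ?_, associated_mul_unit_right _ _ isUnit_omega⟩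
    constructor <;> simp <;> omega

/-- The unit linking two primary elements has imaginary coordinate divisible by `3`; norm `1` then
makes that coordinate zero. -/
theorem eq_or_eq_neg_of_primary_of_associated {x y : Eisenstein} (hx : Primary x)
    (hy : Primary y) (h : Associated x y) : x = y ∨ x = -y := by
  obtain ⟨u, rfl⟩ := h
  have hu := isUnit_iff.1 u.isUnit
  set v : Eisenstein := (u : Eisenstein)
  obtain ⟨⟨a, ha⟩, hx⟩ := hx
  have h3 : (3 : ℤ) ∣ v.im := by
    have := hy.1
    rw [im_mul, ha] at this
    have h4 : (3 : ℤ) ∣ x.re * v.im := by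
      have h5 : x.re * v.im = (x.re * v.im + 3 * a * v.re + -1 * (3 * a) * v.im)
        - 3 * (a * v.re - a * v.im) := by ring
      rw [h5]; exact dvd_sub this (dvd_mul_right _ _)
    exact (Int.prime_three.dvd_or_dvd h4).resolve_left hx
  obtain ⟨b, hb⟩ := h3
  rw [norm_eq, hb] at hu
  have hb0 : b = 0 := by
    by_contra hb0
    have : 1 ≤ b ^ 2 := by
      have := sq_nonneg b
      have : b ^ 2 ≠ 0 := pow_ne_zero 2 hb0
      omega
    nlinarith [sq_nonneg (2 * v.re - 3 * b)]
  rw [hb0] at hu hb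
  have hre : v.re = 1 ∨ v.re = -1 := by
    apply mul_self_eq_one_iff.1; linarith
  rcases hre with h | h
  · left
    have : v = 1 := by ext <;> simp [h, hb, QuadraticAlgebra.re_one, QuadraticAlgebra.im_one]
    rw [this, mul_one]
  · right
    have : v = -1 := by ext <;> simp [h, hb, QuadraticAlgebra.re_one, QuadraticAlgebra.im_one]
    rw [this]; ring

theorem prime_of_norm_eq {x : Eisenstein} {p : ℕ} (hp : p.Prime) (hx : nm x = p) : Prime x := by
  have hx0 : x ≠ 0 := by rintro rfl; simp at hx; exact hp.ne_zero (by exact_mod_cast hx.symm)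
  rw [← irreducible_iff_prime]
  refine ⟨fun h ↦ ?_, fun a b hab ↦ ?_⟩
  · rw [isUnit_iff, hx] at h
    exact hp.one_lt.ne' (by exact_mod_cast h)
  · rw [isUnit_iff, isUnit_iff]
    have h : nm a * nm b = p := by rw [← map_mul, ← hab, hx]
    have hpp := Nat.prime_iff_prime_int.1 hp
    rcases (Irreducible.isUnit_or_isUnit hpp.irreducible h.symm) with h | h
    · left; rcases Int.isUnit_iff.1 h with h | h
      · exact h
      · have := norm_nonneg a; omega
    · right; rcases Int.isUnit_iff.1 h with h | h
      · exact h
      · have := norm_nonneg b; omega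

end Eisenstein

/-! ### Roots of unity in `ℂ`. -/

namespace SimplestCubic

theorem isPrimitiveRoot_zeta {n : ℕ} (hn : n ≠ 0) : IsPrimitiveRoot (zeta n) n := by
  have := Complex.isPrimitiveRoot_exp n hn
  rwa [zeta]

theorem zeta_three_sq : zeta 3 ^ 2 = -1 - zeta 3 := by
  have h := (isPrimitiveRoot_zeta three_ne_zero).geom_sum_eq_zero (by norm_num)
  simp only [Finset.sum_range_succ, Finset.sum_range_zero] at h
  linear_combination h

theorem zeta_pow_div {m n : ℕ} (hn : n ≠ 0) (h : m ∣ n) : zeta n ^ (n / m) = zeta m := by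
  obtain ⟨k, rfl⟩ := h
  have hm : m ≠ 0 := left_ne_zero_of_mul hn
  have hk : k ≠ 0 := right_ne_zero_of_mul hn
  rw [Nat.mul_div_cancel_left _ (Nat.pos_of_ne_zero hm), zeta, zeta, ← Complex.exp_nat_mul]
  congr 1
  have : (m : ℂ) ≠ 0 := by exact_mod_cast hm
  have : (k : ℂ) ≠ 0 := by exact_mod_cast hk
  push_cast
  field_simp

theorem conj_zeta_three : (starRingEnd ℂ) (zeta 3) = -1 - zeta 3 := by
  have h1 : zeta 3 * (starRingEnd ℂ) (zeta 3) = 1 := by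
    rw [Complex.mul_conj, Complex.normSq_eq_norm_sq,
      (isPrimitiveRoot_zeta three_ne_zero).norm'_eq_one three_ne_zero]
    norm_num
  have h2 := zeta_three_sq
  have h3 : zeta 3 ≠ 0 := (isPrimitiveRoot_zeta three_ne_zero).ne_zero three_ne_zero
  apply mul_left_cancel₀ h3
  linear_combination h1 + h2

end SimplestCubic

/-! ### Kummer theory over `ℤ[ω]`: when `x² x̄` is a cube. -/

namespace Eisenstein

open SimplestCubic QuadraticAlgebra ComplexConjugate

/-- The embedding of `ℤ[ω]` into `ℂ`. -/
noncomputable def toComplex : Eisenstein →+* ℂ :=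
  (QuadraticAlgebra.lift (R := ℤ) (a := -1) (b := -1) (A := ℂ) ⟨zeta 3, by
    have := zeta_three_sq
    simp only [zsmul_eq_mul]; push_cast
    linear_combination this⟩ : Eisenstein →ₐ[ℤ] ℂ)

theorem toComplex_apply (x : Eisenstein) : toComplex x = x.re + x.im * zeta 3 := by
  simp [toComplex, QuadraticAlgebra.lift]

theorem toComplex_star (x : Eisenstein) : toComplex (star x) = conj (toComplex x) := by
  simp only [toComplex_apply, map_add, map_mul, conj_zeta_three, re_star, im_star]
  simp
  ring

theorem toComplex_mem {F : IntermediateField ℚ ℂ} (hF : zeta 3 ∈ F) (x : Eisenstein) :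
    toComplex x ∈ F := by
  rw [toComplex_apply]
  exact add_mem (intCast_mem F _) (mul_mem (intCast_mem F _) hF)

theorem toComplex_mul_star (x : Eisenstein) : toComplex x * toComplex (star x) = (nm x : ℂ) := by
  rw [← map_mul, mul_star_eq, map_intCast]

theorem toComplex_surj {z : ℂ} (hz : z ∈ Algebra.adjoin ℤ {zeta 3}) : ∃ x, toComplex x = z := by
  have : Algebra.adjoin ℤ {zeta 3} ≤ (toComplex.toIntAlgHom).range := by
    rw [Algebra.adjoin_le_iff, Set.singleton_subset_iff]
    exact ⟨⟨0, 1⟩, by simp [toComplex_apply]⟩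
  exact this hz

theorem toComplex_injective : Function.Injective toComplex := by
  rw [injective_iff_map_eq_zero]
  intro x hx
  have := toComplex_mul_star x
  rw [hx, zero_mul] at this
  exact norm_eq_zero.1 (by exact_mod_cast this.symm)

/-- `x² x̄` is a cube in the subfield `F` of `ℂ`. -/
def IsCubeIn (F : IntermediateField ℚ ℂ) (x : Eisenstein) : Prop :=
  ∃ ρ ∈ F, ρ ^ 3 = toComplex (x ^ 2 * star x)

variable {F : IntermediateField ℚ ℂ}

/-- The map `x ↦ x² x̄` is multiplicative. It is used in place of `x` because the cube of a cubic
Gauss sum has the shape `J² J̄`, so that no cube root of `J` alone is needed. -/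
theorem IsCubeIn.mul {x y : Eisenstein} (hx : IsCubeIn F x) (hy : IsCubeIn F y) :
    IsCubeIn F (x * y) := by
  obtain ⟨a, ha, hx⟩ := hx
  obtain ⟨b, hb, hy⟩ := hy
  refine ⟨a * b, mul_mem ha hb, ?_⟩
  rw [mul_pow, hx, hy, ← map_mul, star_mul]
  congr 1; ring

theorem IsCubeIn.cube (hF : zeta 3 ∈ F) (x : Eisenstein) : IsCubeIn F (x ^ 3) := by
  refine ⟨toComplex (x ^ 2 * star x), toComplex_mem hF _, ?_⟩
  rw [← map_pow, star_pow]
  congr 1; ring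

theorem IsCubeIn.one : IsCubeIn F 1 := ⟨1, one_mem F, by simp⟩

theorem IsCubeIn.pow {x : Eisenstein} (hx : IsCubeIn F x) (n : ℕ) : IsCubeIn F (x ^ n) := by
  induction n with
  | zero => simpa using IsCubeIn.one
  | succ n ih => rw [pow_succ]; exact ih.mul hx

theorem IsCubeIn.neg_one : IsCubeIn F (-1) := ⟨-1, neg_mem (one_mem F), by simp; norm_num⟩

theorem IsCubeIn.neg {x : Eisenstein} (hx : IsCubeIn F x) : IsCubeIn F (-x) := by
  rw [← neg_one_mul]; exact IsCubeIn.neg_one.mul hx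

/-- If `a³ = x² x̄`, then `(x x̄ / a)³ = x x̄²`. -/
theorem IsCubeIn.star {x : Eisenstein} (hx : IsCubeIn F x) (h0 : x ≠ 0) :
    IsCubeIn F (star x) := by
  obtain ⟨a, ha, hx⟩ := hx
  refine ⟨(nm x : ℂ) / a, div_mem (intCast_mem F _) ha, ?_⟩
  have hn : (nm x : ℂ) ≠ 0 := by exact_mod_cast (norm_pos h0).ne'
  have ha0 : a ^ 3 ≠ 0 := by
    rw [hx, sq, mul_assoc, map_mul, map_mul, toComplex_mul_star]
    exact mul_ne_zero ((map_ne_zero_iff _ toComplex_injective).2 h0) hn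
  rw [div_pow, div_eq_iff ha0, hx, ← map_mul, star_star]
  rw [← map_intCast toComplex, ← map_pow, ← mul_star_eq]
  congr 1; ring

/-- For a unit `u² ū = u`, and `ω = ζ₉³`. This is the source of the factor `9` in the conductor. -/
theorem isCubeIn_of_isUnit (hF : zeta 9 ∈ F) {u : Eisenstein} (hu : IsUnit u) :
    IsCubeIn F u := by
  have h3 : zeta 9 ^ 3 = zeta 3 := zeta_pow_div (m := 3) (n := 9) (by norm_num) (by norm_num)
  have hω : IsCubeIn F ⟨0, 1⟩ := by
    refine ⟨zeta 9, hF, ?_⟩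
    rw [h3, show (⟨0, 1⟩ ^ 2 * star ⟨0, 1⟩ : Eisenstein) = ⟨0, 1⟩ by
      ext <;> simp [sq]]
    simp [toComplex_apply]
  have h1 := isUnit_iff.1 hu
  have key : ∀ w : Eisenstein, nm w = 1 → w = 1 ∨ w = -1 ∨ w = ⟨0, 1⟩ ∨ w = -⟨0, 1⟩ ∨
      w = ⟨0, 1⟩ ^ 2 ∨ w = -⟨0, 1⟩ ^ 2 := by
    intro w hw
    rw [norm_eq] at hw
    have hb : w.im ^ 2 ≤ 1 := by
      have : 3 * w.im ^ 2 ≤ 4 := by nlinarith [sq_nonneg (2 * w.re - w.im)]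
      omega
    have ha : w.re ^ 2 ≤ 1 := by
      have : 3 * w.re ^ 2 ≤ 4 := by nlinarith [sq_nonneg (2 * w.im - w.re)]
      omega
    have hb' := abs_le.1 (sq_le_one_iff_abs_le_one _ |>.1 hb)
    have ha' := abs_le.1 (sq_le_one_iff_abs_le_one _ |>.1 ha)
    obtain ⟨a, b⟩ := w
    simp only at ha' hb' hw
    obtain ⟨a1, a2⟩ := ha'
    obtain ⟨b1, b2⟩ := hb'
    simp only [QuadraticAlgebra.ext_iff]
    interval_cases a <;> interval_cases b <;>
      simp [sq, QuadraticAlgebra.re_one, QuadraticAlgebra.im_one] at hw ⊢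
  rcases key u h1 with h | h | h | h | h | h <;> rw [h]
  · exact IsCubeIn.one
  · exact IsCubeIn.neg_one
  · exact hω
  · exact hω.neg
  · exact hω.pow 2
  · exact (hω.pow 2).neg

end Eisenstein

/-! ### Gauss and Jacobi sums of cubic characters. -/

namespace Eisenstein

open SimplestCubic QuadraticAlgebra ComplexConjugate

variable {F : IntermediateField ℚ ℂ}

/-- Take `J = J(χ, χ)` for a cubic character `χ` mod `p`: it is `-1` mod `3`, has norm `p`, and the
Gauss sum satisfies `g(χ)³ = p J = J² J̄`. -/
theorem exists_primary_isCubeIn_of_prime {p : ℕ} (hp : p.Prime) (hp3 : p % 3 = 1)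
    (hω : zeta 3 ∈ F) (hζ : zeta p ∈ F) :
    ∃ J, Primary J ∧ nm J = p ∧ IsCubeIn F J := by
  have : Fact p.Prime := ⟨hp⟩
  have hroot := isPrimitiveRoot_zeta three_ne_zero
  have hcard : 3 ∣ Fintype.card (ZMod p) - 1 := by rw [ZMod.card]; omega
  obtain ⟨χ, hχ⟩ := MulChar.exists_mulChar_orderOf (ZMod p) hcard hroot
  have hχ3 : χ ^ 3 = 1 := hχ ▸ pow_orderOf_eq_one χ
  have hχ1 : χ ≠ 1 := by rintro rfl; simp at hχ
  have hχ2 : χ * χ ≠ 1 := by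
    rw [← sq]
    intro h
    have := orderOf_dvd_of_pow_eq_one h
    rw [hχ] at this
    norm_num at this
  set ψ := AddChar.zmodChar p ((IsPrimitiveRoot.iff_def (zeta p) p).1
    (isPrimitiveRoot_zeta hp.ne_zero)).1 with hψdef
  have hψ : ψ.IsPrimitive :=
    AddChar.zmodChar_primitive_of_primitive_root p (isPrimitiveRoot_zeta hp.ne_zero)
  obtain ⟨z, hz, hJ⟩ := exists_jacobiSum_eq_neg_one_add (by norm_num : 2 < 3) hχ3 hχ3 hcard hroot
  obtain ⟨z, rfl⟩ := toComplex_surj hz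
  -- The congruence for Jacobi sums is modulo `(ω - 1)² = -3ω`.
  set J : Eisenstein := -1 + z * (-3 * ⟨0, 1⟩) with hJdef
  have hJ' : toComplex J = jacobiSum χ χ := by
    rw [hJ, hJdef]
    have h3 : toComplex ⟨0, 1⟩ = zeta 3 := by simp [toComplex_apply]
    simp only [map_add, map_mul, map_neg, map_one, map_ofNat, h3]
    linear_combination - toComplex z * zeta_three_sq
  have hconj : conj (jacobiSum χ χ) = jacobiSum χ⁻¹ χ⁻¹ := by
    rw [← MulChar.star_eq_inv, ← jacobiSum_ringHomComp χ χ (starRingEnd ℂ)]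
    rfl
  have hnJ : (nm J : ℂ) = p := by
    rw [← toComplex_mul_star, toComplex_star, hJ', hconj,
      jacobiSum_mul_jacobiSum_inv ?_ hχ1 hχ1 hχ2, ZMod.card]
    rw [ringChar.eq_zero, ZMod.ringChar_zmod_n]
    exact hp.ne_zero.symm
  refine ⟨J, ⟨?_, ?_⟩, by exact_mod_cast hnJ, gaussSum χ ψ, ?_, ?_⟩
  · simp [hJdef, QuadraticAlgebra.im_one]
  · simp [hJdef, QuadraticAlgebra.re_one]
  · refine sum_mem fun a _ ↦ mul_mem ?_ ?_
    · obtain ⟨w, hw⟩ := toComplex_surj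
        (MulChar.apply_mem_algebraAdjoin_of_pow_eq_one hχ3 hroot a)
      rw [← hw]
      exact toComplex_mem hω w
    · rw [hψdef, AddChar.zmodChar_apply]
      exact pow_mem hζ _
  · have h1 := gaussSum_pow_eq_prod_jacobiSum (χ := χ) (ψ := ψ) (by rw [hχ]; norm_num) hψ
    -- Both the square and the cube of `χ(-1)` are `1`.
    have hneg : χ (-1) = 1 := by
      have h2 : χ (-1) ^ 2 = 1 := by rw [← map_pow]; simp
      have h3 : χ (-1) ^ 3 = 1 := by
        rw [← MulChar.pow_apply' χ three_ne_zero, hχ3, MulChar.one_apply (by simp)]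
      calc χ (-1) = χ (-1) ^ 3 := by rw [pow_succ, h2, one_mul]
        _ = 1 := h3
    rw [hχ, hneg, ZMod.card] at h1
    norm_num at h1
    rw [h1, sq, mul_assoc, map_mul, map_mul, toComplex_mul_star, hnJ, hJ', mul_comm]

theorem exists_primary_isCubeIn_of_nm_eq {p : ℕ} (hp : p.Prime) (hp3 : p % 3 = 1)
    (hω : zeta 3 ∈ F) (hζ : zeta p ∈ F) {π : Eisenstein} (hπ : nm π = p) :
    ∃ J, Primary J ∧ Associated π J ∧ IsCubeIn F J := by
  obtain ⟨J, hJ, hn, hc⟩ := exists_primary_isCubeIn_of_prime hp hp3 hω hζ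
  have hπp := prime_of_norm_eq hp hπ
  have hJ0 : J ≠ 0 := (prime_of_norm_eq hp hn).ne_zero
  have hdvd : π ∣ J * star J := by
    rw [mul_star_eq, hn, ← hπ, ← mul_star_eq]
    exact dvd_mul_right _ _
  rcases hπp.dvd_or_dvd hdvd with h | h
  · exact ⟨J, hJ, hπp.associated_of_dvd (prime_of_norm_eq hp hn) h, hc⟩
  · refine ⟨star J, hJ.star, hπp.associated_of_dvd (prime_of_norm_eq hp ?_) h, hc.star hJ0⟩
    rw [← hn]; exact QuadraticAlgebra.norm_star J

/-- Both primarity and the cube condition are multiplicative, so prime powers suffice. Exponents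
divisible by `3` are harmless; the other primes are replaced by an associated Jacobi sum or its
conjugate. -/
theorem exists_primary_associated_isCubeIn (hω : zeta 3 ∈ F) {x : Eisenstein}
    (h3 : ¬ 3 ∣ nm x)
    (h : ∀ π, Prime π → π ∣ x → ¬ 3 ∣ multiplicity π x →
      ∃ p : ℕ, p.Prime ∧ nm π = p ∧ p % 3 = 1 ∧ zeta p ∈ F) :
    ∃ y, Primary y ∧ Associated x y ∧ IsCubeIn F y := by
  induction x using UniqueFactorizationMonoid.induction_on_coprime with
  | h0 => simp at h3
  | h1 hu => exact ⟨1, .one, associated_one_iff_isUnit.2 hu, .one⟩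
  | @hpr π i hπ =>
    rcases Nat.eq_zero_or_pos i with rfl | hi
    · exact ⟨1, .one, by simp, .one⟩
    by_cases hi3 : 3 ∣ i
    · obtain ⟨k, rfl⟩ := hi3
      have h4 : ¬ 3 ∣ nm π := fun h5 ↦ h3 (by
        rw [map_pow]; exact dvd_pow h5 hi.ne')
      obtain ⟨y, hy, hxy⟩ := exists_primary_associated h4
      refine ⟨y ^ (3 * k), hy.pow _, hxy.pow_pow, ?_⟩
      rw [mul_comm, pow_mul]
      exact .cube hω _
    · obtain ⟨p, hp, hn, hp3, hζ⟩ := h π hπ (dvd_pow_self π hi.ne')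
        (by rwa [multiplicity_pow_self hπ.ne_zero hπ.not_isUnit])
      obtain ⟨J, hJ, hJa, hJc⟩ := exists_primary_isCubeIn_of_nm_eq hp hp3 hω hζ hn
      exact ⟨J ^ i, hJ.pow i, hJa.pow_pow, hJc.pow i⟩
  | @hcp x y hxy hx hy =>
    have hne : x * y ≠ 0 := by rintro h0; simp [h0] at h3
    rw [map_mul] at h3
    have aux : ∀ {x y : Eisenstein}, IsRelPrime x y → x * y ≠ 0 → ∀ π, Prime π → π ∣ x →
        multiplicity π (x * y) = multiplicity π x := by
      intro x y hxy hne π hπ hd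
      have hπy : ¬ π ∣ y := fun h' ↦ hπ.not_isUnit (hxy hd h')
      rw [multiplicity_mul hπ (FiniteMultiplicity.of_prime_left hπ hne),
        multiplicity_eq_zero.2 hπy, add_zero]
    obtain ⟨a, ha, hxa, hac⟩ := hx (fun h' ↦ h3 (dvd_mul_of_dvd_left h' _)) fun π hπ hd hm ↦
      h π hπ (dvd_mul_of_dvd_left hd _) (by rwa [aux hxy hne π hπ hd])
    obtain ⟨b, hb, hyb, hbc⟩ := hy (fun h' ↦ h3 (dvd_mul_of_dvd_right h' _)) fun π hπ hd hm ↦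
      h π hπ (dvd_mul_of_dvd_right hd _) (by
        rwa [mul_comm, aux hxy.symm (by rwa [mul_comm]) π hπ hd])
    exact ⟨a * b, ha.mul hb, hxa.mul_mul hyb, hac.mul hbc⟩

/-- An Eisenstein integer without rational prime factors and of norm prime to `3`. -/
theorem exists_primary_associated_isCubeIn_of_primitive (hω : zeta 3 ∈ F) {x : Eisenstein}
    (h3 : ¬ 3 ∣ nm x) (hprim : ∀ p : ℕ, p.Prime → ¬ (p : Eisenstein) ∣ x)
    (h : ∀ p : ℕ, p.Prime → p % 3 = 1 → ¬ 3 ∣ padicValInt p (nm x) → zeta p ∈ F) :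
    ∃ y, Primary y ∧ Associated x y ∧ IsCubeIn F y := by
  have hx0 : x ≠ 0 := by rintro rfl; simp at h3
  refine exists_primary_associated_isCubeIn hω h3 fun π hπ hd hm ↦ ?_
  obtain ⟨p, hp, hdp⟩ : ∃ p : ℕ, p.Prime ∧ π ∣ (p : Eisenstein) := by
    have h1 : π ∣ ((nm π).natAbs : Eisenstein) := by
      have : ((nm π).natAbs : Eisenstein) = (nm π : Eisenstein) := by
        rw [← Int.cast_natCast, Int.natAbs_of_nonneg (norm_nonneg π)]
      rw [this, ← mul_star_eq]
      exact dvd_mul_right _ _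
    rw [← Nat.prod_primeFactorsList (n := (nm π).natAbs)
      (Int.natAbs_ne_zero.2 (norm_pos hπ.ne_zero).ne'), Nat.cast_list_prod,
      hπ.dvd_prod_iff] at h1
    obtain ⟨a, ha, hda⟩ := h1
    obtain ⟨p, hp, rfl⟩ := List.mem_map.1 ha
    exact ⟨p, Nat.prime_of_mem_primeFactorsList hp, hda⟩
  have hnd : nm π ∣ (p : ℤ) ^ 2 := by
    have := map_dvd nm hdp
    rwa [show nm (p : Eisenstein) = (p : ℤ) ^ 2 from QuadraticAlgebra.norm_natCast p] at this
  have hnn := norm_nonneg π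
  have hnp : nm π = p := by
    lift nm π to ℕ using hnn with n hn
    norm_cast at hnd ⊢
    obtain ⟨i, hi, rfl⟩ := (Nat.dvd_prime_pow hp).1 hnd
    interval_cases i
    · exact absurd (isUnit_iff.2 (by rw [← hn]; simp)) hπ.not_isUnit
    · simp
    -- Here `π` would be inert, hence associated to `p`, and `p` would divide `x`.
    · exfalso
      obtain ⟨w, hw⟩ := hdp
      have h4 := congrArg nm hw
      rw [show nm (p : Eisenstein) = (p : ℤ) ^ 2 from QuadraticAlgebra.norm_natCast p, map_mul,
        ← hn] at h4
      push_cast at h4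
      have h5 : nm w = 1 := by
        have : (p : ℤ) ^ 2 ≠ 0 := pow_ne_zero 2 (by exact_mod_cast hp.ne_zero)
        apply mul_left_cancel₀ this
        rw [← h4, mul_one]
      apply hprim p hp
      rw [hw]
      exact ((isUnit_iff.2 h5).mul_right_dvd).2 hd
  have hpx : (p : ℤ) ∣ nm x := hnp ▸ map_dvd nm hd
  have hp3 : p % 3 = 1 := by
    have h4 : (p : ℤ) % 3 ≠ 0 := fun h5 ↦ by
      have : (p : ℤ) = 3 := by
        have : 3 ∣ p := by omega
        exact_mod_cast ((Nat.prime_dvd_prime_iff_eq Nat.prime_three hp).1 this).symm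
      exact h3 (this ▸ hpx)
    rw [norm_eq] at hnp
    have h5 : (p : ℤ) = (π.re + π.im) ^ 2 + 3 * (- π.re * π.im) := by rw [← hnp]; ring
    have h6 : (p : ℤ) % 3 = (π.re + π.im) ^ 2 % 3 := by rw [h5]; omega
    have h7 : (π.re + π.im) % 3 = 0 ∨ (π.re + π.im) % 3 = 1 ∨ (π.re + π.im) % 3 = 2 := by omega
    rcases h7 with h7 | h7 | h7 <;> simp [sq, Int.mul_emod, h7] at h6 <;> omega
  refine ⟨p, hp, hnp, hp3, h p hp hp3 ?_⟩
  -- `π` does not divide the conjugate of `x`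
  have hstar : ¬ π ∣ star x := by
    intro hs
    obtain ⟨u, hu⟩ := hd
    obtain ⟨v, hv⟩ := hs
    -- then `p ∣ 2 re x - im x` and `p ∣ 3 im x`
    have hdvd : ∀ z : ℤ, π ∣ (z : Eisenstein) → (p : ℤ) ∣ z := by
      intro z hz
      have := map_dvd nm hz
      rw [hnp, show nm (z : Eisenstein) = z ^ 2 from QuadraticAlgebra.norm_intCast z] at this
      exact (Nat.prime_iff_prime_int.1 hp).dvd_of_dvd_pow this
    have h1 : (p : ℤ) ∣ 2 * x.re - x.im := hdvd _ (by
      have : ((2 * x.re - x.im : ℤ) : Eisenstein) = x + star x := by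
        ext <;> simp; ring
      rw [this]
      exact dvd_add ⟨u, hu⟩ ⟨v, hv⟩)
    have hsub : x - star x = (x.im : Eisenstein) * ⟨1, 2⟩ := by
      ext <;> simp; ring
    have h2 : (p : ℤ) ∣ x.im := by
      have h4 : π ∣ (x.im : Eisenstein) * ⟨1, 2⟩ := by
        rw [← hsub]
        exact dvd_sub ⟨u, hu⟩ ⟨v, hv⟩
      rcases hπ.dvd_or_dvd h4 with h5 | h5
      · exact hdvd _ h5
      · have := map_dvd nm h5
        rw [hnp, norm_eq] at this
        norm_num at this
        have h6 : p ∣ 3 := by exact_mod_cast this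
        rw [Nat.prime_dvd_prime_iff_eq hp Nat.prime_three] at h6
        omega
    have h5 : (p : ℤ) ∣ x.re := by
      have h6 : (p : ℤ) ∣ 2 * x.re := by
        have := dvd_add h1 h2
        simpa using this
      rcases (Nat.prime_iff_prime_int.1 hp).dvd_or_dvd h6 with h7 | h7
      · have h8 : p ∣ 2 := by exact_mod_cast h7
        rw [Nat.prime_dvd_prime_iff_eq hp Nat.prime_two] at h8
        omega
      · exact h7
    obtain ⟨a, ha⟩ := h5
    obtain ⟨b, hb⟩ := h2
    exact hprim p hp ⟨⟨a, b⟩, by ext <;> simp [ha, hb]⟩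
  -- As `π` does not divide `x̄`, all of its multiplicity in `x x̄` comes from `x`.
  have hval : padicValInt p (nm x) = multiplicity π x := by
    have : Fact p.Prime := ⟨hp⟩
    have hfin := FiniteMultiplicity.of_prime_left hπ hx0
    apply le_antisymm
    · apply FiniteMultiplicity.le_multiplicity_of_pow_dvd hfin
      have h1 : π ^ padicValInt p (nm x) ∣ (nm x : Eisenstein) := by
        have h2 : (p : ℤ) ^ padicValInt p (nm x) ∣ nm x := padicValInt_dvd (nm x)
        have h3' : ((p : Eisenstein)) ^ padicValInt p (nm x) ∣ (nm x : Eisenstein) := by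
          have := map_dvd (Int.castRingHom Eisenstein) h2
          simpa using this
        exact (pow_dvd_pow_of_dvd hdp _).trans h3'
      rw [← mul_star_eq] at h1
      exact hπ.pow_dvd_of_dvd_mul_right _ hstar h1
    · have h1 := map_dvd nm (pow_multiplicity_dvd π x)
      rw [map_pow, hnp] at h1
      exact (padicValInt_dvd_iff _ _).1 h1 |>.resolve_left (norm_pos hx0).ne'
  rwa [hval]

end Eisenstein

/-! ### Roots of Shanks' cubic over a general field. -/

namespace SimplestCubic

open Polynomial IntermediateField

theorem aeval_shanksPoly {A : Type*} [CommRing A] (t : ℤ) (x : A) :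
    aeval x (shanksPoly t) = x ^ 3 - t * x ^ 2 - (t + 3) * x - 1 := by
  simp only [shanksPoly, map_sub, map_mul, map_pow, aeval_X, map_one, eq_intCast,
    map_add, map_intCast, map_ofNat]

theorem Delta_pos (t : ℤ) : 0 < Delta t := by
  unfold Delta; nlinarith [sq_nonneg (2 * t + 3)]

section Roots

variable {L : Type*} [Field L] {t : ℤ} {x y : L}

theorem ne_zero_of_root (hx : x ^ 3 - t * x ^ 2 - (t + 3) * x - 1 = 0) : x ≠ 0 := by
  rintro rfl; simp at hx

theorem one_add_ne_zero_of_root (hx : x ^ 3 - t * x ^ 2 - (t + 3) * x - 1 = 0) : 1 + x ≠ 0 := by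
  intro h
  have : x = -1 := by linear_combination h
  rw [this] at hx
  ring_nf at hx
  exact one_ne_zero hx

/-- The map `x ↦ -1/(1 + x)` permutes the roots cyclically, so one root in a field brings in all of
them. -/
theorem root_eq (hx : x ^ 3 - t * x ^ 2 - (t + 3) * x - 1 = 0)
    (hy : y ^ 3 - t * y ^ 2 - (t + 3) * y - 1 = 0) :
    y = x ∨ y = -1 / (1 + x) ∨ y = -(1 + x) / x := by
  have h0 := ne_zero_of_root hx
  have h1 := one_add_ne_zero_of_root hx
  have : (y - x) * (y - -1 / (1 + x)) * (y - -(1 + x) / x) = 0 := by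
    field_simp
    linear_combination (x * (1 + x)) * hy + (- (y ^ 2 + y)) * hx
  rcases mul_eq_zero.1 this with h | h
  · rcases mul_eq_zero.1 h with h | h
    · exact Or.inl (sub_eq_zero.1 h)
    · exact Or.inr (Or.inl (sub_eq_zero.1 h))
  · exact Or.inr (Or.inr (sub_eq_zero.1 h))

theorem mem_of_root_mem {F : IntermediateField ℚ ℂ} {x y : ℂ}
    (hx : x ^ 3 - t * x ^ 2 - (t + 3) * x - 1 = 0)
    (hy : y ^ 3 - t * y ^ 2 - (t + 3) * y - 1 = 0) (hxF : x ∈ F) : y ∈ F := by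
  rcases root_eq hx hy with rfl | rfl | rfl
  · exact hxF
  · exact div_mem (neg_mem (one_mem F)) (add_mem (one_mem F) hxF)
  · exact div_mem (neg_mem (add_mem (one_mem F) hxF)) hxF

theorem natDegree_minpoly_of_no_root {F : Type*} [Field F] [Algebra F L]
    (hx : x ^ 3 - t * x ^ 2 - (t + 3) * x - 1 = 0)
    (h : ∀ z : F, z ^ 3 - t * z ^ 2 - (t + 3) * z - 1 ≠ 0) :
    (minpoly F x).natDegree = 3 := by
  set f : F[X] := X ^ 3 - C (t : F) * X ^ 2 - C (t + 3 : F) * X - 1 with hf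
  have hdeg : f.natDegree = 3 := by rw [hf]; compute_degree!
  have hmon : f.Monic := by rw [hf]; monicity!
  have hirr : Irreducible f := by
    rw [Polynomial.irreducible_iff_roots_eq_zero_of_degree_le_three (by omega) (by omega)]
    rw [Multiset.eq_zero_iff_forall_notMem]
    intro z hz
    have := (mem_roots'.1 hz).2
    simp only [hf, IsRoot, eval_sub, eval_pow, eval_X, eval_mul, eval_C, eval_one] at this
    exact h z this
  rw [← minpoly.eq_of_irreducible_of_monic hirr ?_ hmon, hdeg]
  simpa only [hf, map_sub, map_mul, map_pow, aeval_X, aeval_C, map_one, map_add, map_intCast,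
    map_ofNat] using hx

end Roots

/-- Over `F` the root has degree `1` or `3`, and degree `3` does not fit in an extension of degree
at most `2`. This removes an auxiliary `ζ₃`, and later descends from `ℚ(ζ₉)` to its real subfield.
-/
theorem root_mem_of_mem_adjoin_quadratic {F : IntermediateField ℚ ℂ} {t : ℤ} {θ w b c : ℂ}
    (hθ : θ ^ 3 - t * θ ^ 2 - (t + 3) * θ - 1 = 0) (hb : b ∈ F) (hc : c ∈ F)
    (hw : w ^ 2 + b * w + c = 0) (h : θ ∈ adjoin F {w}) : θ ∈ F := by
  by_contra hcon
  have h3 : (minpoly F θ).natDegree = 3 := by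
    apply natDegree_minpoly_of_no_root hθ
    intro z hz
    apply hcon
    refine mem_of_root_mem (x := z) (t := t) ?_ hθ z.2
    have := congrArg (algebraMap F ℂ) hz
    simp only [map_sub, map_mul, map_pow, map_add, map_intCast, map_ofNat, map_one,
      map_zero] at this
    exact this
  set q : F[X] := X ^ 2 + C ⟨b, hb⟩ * X + C ⟨c, hc⟩ with hq
  have hqm : q.Monic := by rw [hq]; monicity!
  have hqd : q.natDegree = 2 := by rw [hq]; compute_degree!
  have hq0 : aeval w q = 0 := by
    simp only [hq, map_add, map_pow, aeval_X, map_mul, aeval_C]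
    exact hw
  have hint : IsIntegral F w := ⟨q, hqm, hq0⟩
  have hle : Module.finrank F (adjoin F {w}) ≤ 2 := by
    rw [adjoin.finrank hint, ← hqd]
    exact natDegree_le_of_dvd (minpoly.dvd F w hq0) hqm.ne_zero
  have : FiniteDimensional F (adjoin F {w}) := adjoin.finiteDimensional hint
  have h4 := minpoly.natDegree_le (A := F) (⟨θ, h⟩ : adjoin F {w})
  have h5 : minpoly F (⟨θ, h⟩ : adjoin F {w}) = minpoly F θ := by
    rw [← minpoly.algebraMap_eq (algebraMap (adjoin F {w}) ℂ).injective]; rfl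
  rw [h5, h3] at h4
  omega

/-- Cardano's formula: with `ρ³ = δ Δ_t`, the number `(t + ρ + Δ_t/ρ)/3` is a root, because `ρ³ +
(Δ_t/ρ)³ = Δ_t (δ + δ̄)` and `δ + δ̄ = 2t + 3`. -/
theorem root_mem_of_cube {F : IntermediateField ℚ ℂ} {t : ℤ} {θ : ℂ}
    (hθ : θ ^ 3 - t * θ ^ 2 - (t + 3) * θ - 1 = 0)
    (h : Eisenstein.IsCubeIn F ⟨t, -3⟩) : θ ∈ F := by
  obtain ⟨ρ, hρF, hρ⟩ := h
  set δ : Eisenstein := ⟨t, -3⟩ with hδ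
  have hn : Eisenstein.nm δ = Delta t := by rw [Eisenstein.norm_eq, hδ, Delta]; ring
  have hΔ : (Delta t : ℂ) ≠ 0 := by exact_mod_cast (Delta_pos t).ne'
  have hmul := Eisenstein.toComplex_mul_star δ
  rw [hn] at hmul
  rw [map_mul, map_pow] at hρ
  set d := Eisenstein.toComplex δ
  set d' := Eisenstein.toComplex (star δ)
  have hd : d ≠ 0 := left_ne_zero_of_mul (hmul ▸ hΔ)
  have hρ' : ρ ^ 3 = d * Delta t := by rw [hρ, ← hmul]; ring
  have hρ0 : ρ ≠ 0 := by
    rintro rfl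
    rw [zero_pow three_ne_zero] at hρ'
    exact mul_ne_zero hd hΔ hρ'.symm
  have hsum : d + d' = 2 * t + 3 := by
    rw [← map_add, Eisenstein.toComplex_apply, hδ]
    simp
    ring
  have hy3 : (Delta t / ρ) ^ 3 = d' * Delta t := by
    rw [div_pow, div_eq_iff (pow_ne_zero 3 hρ0), hρ']
    linear_combination - (Delta t : ℂ) ^ 2 * hmul
  have hprod : ρ * (Delta t / ρ) = Delta t := by field_simp
  refine mem_of_root_mem (x := (t + ρ + Delta t / ρ) / 3) (t := t) ?_ hθ ?_
  · set r := (Delta t : ℂ) / ρ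
    have hD : (Delta t : ℂ) = t ^ 2 + 3 * t + 9 := by simp [Delta]
    have : (27 : ℂ) * (((t + ρ + r) / 3) ^ 3 - t * ((t + ρ + r) / 3) ^ 2
        - (t + 3) * ((t + ρ + r) / 3) - 1) = 0 := by
      linear_combination hρ' + hy3 + (Delta t : ℂ) * hsum + 3 * (ρ + r) * hprod
        + (3 * (ρ + r) + (2 * t + 3)) * hD
    simpa using this
  · exact div_mem (add_mem (add_mem (intCast_mem F t) hρF) (div_mem (intCast_mem F _) hρF))
      (ofNat_mem F 3)

theorem zeta_mem_adjoin_zeta {m n : ℕ} (hn : n ≠ 0) (h : m ∣ n) :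
    zeta m ∈ adjoin ℚ {zeta n} := by
  rw [← zeta_pow_div hn h]
  exact pow_mem (mem_adjoin_simple_self ℚ _) _

/-! ### The explicit conductor, and `θ` in the corresponding cyclotomic field. -/

/-- The primes `p ≠ 3` with `3 ∤ v_p(Δ_t)`. -/
def tamePrimes (t : ℤ) : Finset ℕ :=
  (Delta t).natAbs.primeFactors.filter fun p ↦ p ≠ 3 ∧ ¬ 3 ∣ padicValInt p (Delta t)

/-- The explicit value of the conductor of the simplest cubic field with parameter `t`. -/
def explicitConductor (t : ℤ) : ℕ :=
  (if 3 ∣ t ∧ ¬ t ≡ 12 [ZMOD 27] then 9 else 1) * ∏ p ∈ tamePrimes t, p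

theorem mem_tamePrimes {t : ℤ} {p : ℕ} :
    p ∈ tamePrimes t ↔ p.Prime ∧ p ≠ 3 ∧ ¬ 3 ∣ padicValInt p (Delta t) := by
  rw [tamePrimes, Finset.mem_filter, Nat.mem_primeFactors]
  constructor
  · rintro ⟨⟨h1, -, -⟩, h2⟩
    exact ⟨h1, h2⟩
  · rintro ⟨h1, h2, h3⟩
    refine ⟨⟨h1, ?_, Int.natAbs_ne_zero.2 (Delta_pos t).ne'⟩, h2, h3⟩
    by_contra h4
    apply h3
    rw [padicValInt, padicValNat.eq_zero_of_not_dvd h4]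
    exact dvd_zero 3

theorem prod_tamePrimes_ne_zero (t : ℤ) : ∏ p ∈ tamePrimes t, p ≠ 0 :=
  Finset.prod_ne_zero_iff.2 fun _ hp ↦ (mem_tamePrimes.1 hp).1.ne_zero

theorem explicitConductor_ne_zero (t : ℤ) : explicitConductor t ≠ 0 :=
  mul_ne_zero (by split_ifs <;> norm_num) (prod_tamePrimes_ne_zero t)

section

open Eisenstein

theorem natCast_dvd_iff {p : ℕ} {x : Eisenstein} :
    (p : Eisenstein) ∣ x ↔ (p : ℤ) ∣ x.re ∧ (p : ℤ) ∣ x.im := by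
  constructor
  · rintro ⟨y, rfl⟩
    constructor <;> simp
  · rintro ⟨⟨a, ha⟩, ⟨b, hb⟩⟩
    exact ⟨⟨a, b⟩, by ext <;> simp [ha, hb]⟩

/-- Here `δ` is itself primary, so the unit ambiguity is only a sign and `ζ₉` is not needed. -/
theorem isCubeIn_of_not_three_dvd {F : IntermediateField ℚ ℂ} {t : ℤ} (h3 : ¬ 3 ∣ t)
    (hω : zeta 3 ∈ F) (hF : ∀ p ∈ tamePrimes t, zeta p ∈ F) : IsCubeIn F ⟨t, -3⟩ := by
  have hn : nm ⟨t, -3⟩ = Delta t := by rw [norm_eq, Delta]; ring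
  have hx : Primary ⟨t, -3⟩ := ⟨by simp, h3⟩
  obtain ⟨y, hy, hxy, hc⟩ := exists_primary_associated_isCubeIn_of_primitive (F := F) hω
    (x := ⟨t, -3⟩) (by rw [not_three_dvd_norm]; simp only; omega) (fun p hp hd ↦ by
      obtain ⟨h1, h2⟩ := natCast_dvd_iff.1 hd
      have h4 : p ∣ 3 := by simpa using Int.natAbs_dvd_natAbs.2 h2
      rw [(Nat.prime_dvd_prime_iff_eq hp Nat.prime_three).1 h4] at h1
      exact h3 h1) (fun p hp hp3 hv ↦ hF p (mem_tamePrimes.2 ⟨hp, by omega, hn ▸ hv⟩))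
  rcases eq_or_eq_neg_of_primary_of_associated hx hy hxy with h | h
  · rwa [h]
  · rw [h]; exact hc.neg

theorem padicValInt_mul_of_not_dvd {p : ℕ} (hp : p.Prime) {a b : ℤ} (ha : ¬ (p : ℤ) ∣ a)
    (hb : b ≠ 0) : padicValInt p (a * b) = padicValInt p b := by
  have : Fact p.Prime := ⟨hp⟩
  rw [padicValInt.mul (by rintro rfl; simp at ha) hb, padicValInt.eq_zero_of_not_dvd ha, zero_add]

/-- Now `δ = 3(s - ω)` with `s - ω` of norm prime to `3`. The factor `3` contributes `3² · 3 = 3³`,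
and `ζ₉` absorbs the unit. -/
theorem isCubeIn_of_mod_nine {F : IntermediateField ℚ ℂ} {s : ℤ} (hs : ¬ s ≡ 1 [ZMOD 3])
    (h9 : zeta 9 ∈ F) (hω : zeta 3 ∈ F) (hF : ∀ p ∈ tamePrimes (3 * s), zeta p ∈ F) :
    IsCubeIn F ⟨3 * s, -3⟩ := by
  have hn : nm ⟨3 * s, -3⟩ = Delta (3 * s) := by rw [norm_eq, Delta]; ring
  have hn' : Delta (3 * s) = 9 * nm ⟨s, -1⟩ := by rw [norm_eq, Delta]; ring
  have h0 : nm ⟨s, -1⟩ ≠ 0 := by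
    intro h; rw [h] at hn'; exact (Delta_pos (3 * s)).ne' (by simpa using hn')
  obtain ⟨y, hy, hxy, hc⟩ := exists_primary_associated_isCubeIn_of_primitive (F := F) hω
    (x := ⟨s, -1⟩) (by
      rw [not_three_dvd_norm]; simp only; intro h
      exact hs (by unfold Int.ModEq; omega)) (fun p hp hd ↦ by
      obtain ⟨h1, h2⟩ := natCast_dvd_iff.1 hd
      have h4 : p ∣ 1 := by simpa using Int.natAbs_dvd_natAbs.2 h2
      exact hp.one_lt.ne' (Nat.dvd_one.1 h4)) (fun p hp hp3 hv ↦
        hF p (mem_tamePrimes.2 ⟨hp, by omega, by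
          rwa [hn', padicValInt_mul_of_not_dvd hp _ h0]
          intro h
          have h4 : p ∣ 3 ^ 2 := by exact_mod_cast h
          have := (Nat.prime_dvd_prime_iff_eq hp Nat.prime_three).1 (hp.dvd_of_dvd_pow h4)
          omega⟩))
  obtain ⟨u, hu⟩ := hxy.symm
  have h3 : IsCubeIn F ⟨3, 0⟩ := ⟨3, ofNat_mem F 3, by
    rw [show (⟨3, 0⟩ ^ 2 * star ⟨3, 0⟩ : Eisenstein) = ⟨27, 0⟩ by ext <;> simp [sq],
      toComplex_apply]
    norm_num⟩
  have : (⟨3 * s, -3⟩ : Eisenstein) = ⟨3, 0⟩ * (y * u) := by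
    rw [hu]; ext <;> simp
  rw [this]
  exact h3.mul (hc.mul (isCubeIn_of_isUnit h9 u.isUnit))

/-- Here `δ` is `(1 - ω)³` times `(1 + r) + (1 + 2r)ω`. The cofactor is primary exactly when `3 ∣ 1
+ 2r`, that is `t ≡ 12 mod 27`; only otherwise is `ζ₉` called on. -/
theorem isCubeIn_of_eq_three_add {F : IntermediateField ℚ ℂ} {r : ℤ} (hω : zeta 3 ∈ F)
    (h : 3 ∣ 1 + 2 * r ∨ zeta 9 ∈ F) (hF : ∀ p ∈ tamePrimes (3 + 9 * r), zeta p ∈ F) :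
    IsCubeIn F ⟨3 + 9 * r, -3⟩ := by
  have hn' : Delta (3 + 9 * r) = 27 * nm ⟨1 + r, 1 + 2 * r⟩ := by rw [norm_eq, Delta]; ring
  have h0 : nm ⟨1 + r, 1 + 2 * r⟩ ≠ 0 := by
    intro h; rw [h] at hn'; exact (Delta_pos (3 + 9 * r)).ne' (by simpa using hn')
  have hl : (⟨3 + 9 * r, -3⟩ : Eisenstein) = ⟨1, -1⟩ ^ 3 * ⟨1 + r, 1 + 2 * r⟩ := by
    ext <;> simp [pow_succ] <;> ring
  rw [hl]
  apply (IsCubeIn.cube hω _).mul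
  obtain ⟨y, hy, hxy, hc⟩ := exists_primary_associated_isCubeIn_of_primitive (F := F) hω
    (x := ⟨1 + r, 1 + 2 * r⟩) (by rw [not_three_dvd_norm]; simp only; omega) (fun p hp hd ↦ by
      obtain ⟨h1, h2⟩ := natCast_dvd_iff.1 hd
      have h4 : (p : ℤ) ∣ 1 := by
        have := dvd_sub (dvd_mul_of_dvd_right h1 2) h2
        simp only at this
        rwa [show 2 * (1 + r) - (1 + 2 * r) = 1 by ring] at this
      have h5 : p ∣ 1 := by exact_mod_cast h4
      exact hp.one_lt.ne' (Nat.dvd_one.1 h5)) (fun p hp hp3 hv ↦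
        hF p (mem_tamePrimes.2 ⟨hp, by omega, by
          rwa [hn', padicValInt_mul_of_not_dvd hp _ h0]
          intro h
          have h4 : p ∣ 3 ^ 3 := by exact_mod_cast h
          have := (Nat.prime_dvd_prime_iff_eq hp Nat.prime_three).1 (hp.dvd_of_dvd_pow h4)
          omega⟩))
  rcases h with h | h
  · have hx : Primary ⟨1 + r, 1 + 2 * r⟩ := ⟨h, by simp only; omega⟩
    rcases eq_or_eq_neg_of_primary_of_associated hx hy hxy with h | h
    · rwa [h]
    · rw [h]; exact hc.neg
  · obtain ⟨u, hu⟩ := hxy.symm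
    rw [← hu]
    exact hc.mul (isCubeIn_of_isUnit h u.isUnit)

end

theorem root_mem_adjoin_explicitConductor {t : ℤ} {θ : ℂ}
    (hθ : θ ^ 3 - t * θ ^ 2 - (t + 3) * θ - 1 = 0) :
    θ ∈ adjoin ℚ {zeta (explicitConductor t)} := by
  by_cases h : 3 ∣ t ∧ ¬ t ≡ 12 [ZMOD 27]
  · set F := adjoin ℚ {zeta (explicitConductor t)}
    have hc : explicitConductor t = 9 * ∏ p ∈ tamePrimes t, p := by
      rw [explicitConductor, if_pos h]
    have h9 : zeta 9 ∈ F := zeta_mem_adjoin_zeta (explicitConductor_ne_zero t) ⟨_, hc⟩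
    have hω : zeta 3 ∈ F := zeta_mem_adjoin_zeta (explicitConductor_ne_zero t)
      (hc ▸ Dvd.dvd.mul_right (by norm_num) _)
    have hp : ∀ p ∈ tamePrimes t, zeta p ∈ F := fun p hp ↦
      zeta_mem_adjoin_zeta (explicitConductor_ne_zero t)
        (hc ▸ (Finset.dvd_prod_of_mem _ hp).mul_left _)
    apply root_mem_of_cube hθ
    obtain ⟨s, rfl⟩ := h.1
    by_cases hs : s ≡ 1 [ZMOD 3]
    · obtain ⟨r, hr⟩ := hs.symm.dvd
      have hs' : 3 * s = 3 + 9 * r := by omega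
      rw [hs'] at hp ⊢
      exact isCubeIn_of_eq_three_add hω (Or.inr h9) hp
    · exact isCubeIn_of_mod_nine hs h9 hω hp
  · set F := adjoin ℚ {zeta (explicitConductor t)}
    have hc : explicitConductor t = ∏ p ∈ tamePrimes t, p := by
      rw [explicitConductor, if_neg h, one_mul]
    -- The field `F` need not contain `ζ₃`; adjoining it is an extension of degree at most `2`.
    refine root_mem_of_mem_adjoin_quadratic (F := F) (w := zeta 3) (b := 1) (c := 1) hθ
      (one_mem F) (one_mem F) (by linear_combination zeta_three_sq) ?_
    rw [← mem_restrictScalars ℚ]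
    set G := restrictScalars ℚ (adjoin F {zeta 3})
    have hω : zeta 3 ∈ G := mem_adjoin_simple_self F _
    have hp : ∀ p ∈ tamePrimes t, zeta p ∈ G := fun p hp ↦ by
      have : zeta p ∈ F := zeta_mem_adjoin_zeta (explicitConductor_ne_zero t)
        (hc ▸ Finset.dvd_prod_of_mem _ hp)
      exact (adjoin F {zeta 3}).algebraMap_mem ⟨_, this⟩
    apply root_mem_of_cube hθ
    by_cases h3 : 3 ∣ t
    · have h12 : t ≡ 12 [ZMOD 27] := by tauto
      obtain ⟨r, hr⟩ := h12.symm.dvd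
      have ht : t = 3 + 9 * (1 + 3 * r) := by omega
      rw [ht] at hp ⊢
      exact isCubeIn_of_eq_three_add hω (Or.inl (by omega)) hp
    · exact isCubeIn_of_not_three_dvd h3 hω hp

end SimplestCubic

/-! ### Units of a cyclic cubic field as a lattice with Galois action. -/

/-- On a lattice of rank one or two with an automorphism `s` satisfying `s² + s + 1 = 0`, the image
of `s - 1` has index `3`. -/
theorem AddMonoidHom.index_range_sub_id {M : Type*} [AddCommGroup M] [Module.Free ℤ M]
    [Module.Finite ℤ M] (h1 : 1 ≤ Module.finrank ℤ M) (h2 : Module.finrank ℤ M ≤ 2)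
    (s : M →+ M) (hs : ∀ x, s (s x) + s x + x = 0) :
    (s - AddMonoidHom.id M).range.index = 3 := by
  set φ := s - AddMonoidHom.id M with hφ
  have hφa : ∀ x, φ x = s x - x := fun x ↦ rfl
  have h3inj : ∀ x : M, (3 : ℤ) • x = 0 → x = 0 := fun x hx ↦
    (smul_eq_zero.1 hx).resolve_left (by norm_num)
  have hinj : φ.ker = ⊥ := by
    rw [AddMonoidHom.ker_eq_bot_iff, injective_iff_map_eq_zero]
    intro x hx
    have hsx : s x = x := sub_eq_zero.1 hx
    apply h3inj
    have := hs x
    rw [hsx, hsx] at this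
    rw [← this]; abel
  have hsq : ∀ x, φ (φ x) = -((3 : ℕ) • s x) := by
    intro x
    have h : s (s x) = - s x - x := by
      rw [eq_sub_iff_add_eq, eq_neg_iff_add_eq_zero, ← hs x]; abel
    rw [hφa, hφa, map_sub, h]; abel
  have hs3 : ∀ x, s (s (s x)) = x := by
    intro x
    have e1 := hs x
    have e2 := hs (s x)
    have : s (s (s x)) + s (s x) + s x = s (s x) + s x + x := by rw [e1, e2]
    have h4 : s (s (s x)) + (s (s x) + s x) = x + (s (s x) + s x) := by
      rw [← add_assoc, this]; abel
    exact add_right_cancel h4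
  -- Since `(s - 1)² = -3s` with `s` invertible, the square of the index is `3 ^ rank`. Rank `1` is
  -- excluded because `3` is not a square.
  have hmap : φ.range.map φ = (nsmulAddMonoidHom (α := M) 3).range := by
    ext y
    simp only [AddSubgroup.mem_map, AddMonoidHom.mem_range, exists_exists_eq_and,
      nsmulAddMonoidHom_apply]
    constructor
    · rintro ⟨x, rfl⟩
      exact ⟨-s x, by rw [hsq, smul_neg]⟩
    · rintro ⟨x, rfl⟩
      exact ⟨-(s (s x)), by rw [hsq, map_neg, hs3, smul_neg, neg_neg]⟩
  have hind := AddSubgroup.index_map φ.range φ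
  rw [hinj, sup_bot_eq, hmap, AddSubgroup.index_range_nsmul] at hind
  interval_cases h : Module.finrank ℤ M
  · have : IsSquare 3 := ⟨_, by simpa using hind⟩
    exact absurd this (Nat.prime_three.not_isSquare)
  · have : φ.range.index * φ.range.index = 3 * 3 := by omega
    exact Nat.mul_self_inj.1 this

theorem AddMonoidHom.exists_nsmul_add_of_notMem_range {M : Type*} [AddCommGroup M]
    [Module.Free ℤ M] [Module.Finite ℤ M] (h1 : 1 ≤ Module.finrank ℤ M)
    (h2 : Module.finrank ℤ M ≤ 2) (s : M →+ M) (hs : ∀ x, s (s x) + s x + x = 0) {x : M}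
    (hx : ∀ z, x ≠ s z - z) (y : M) : ∃ (j : ℕ) (z : M), y = j • x + (s z - z) := by
  have hind := AddMonoidHom.index_range_sub_id h1 h2 s hs
  set φ := s - AddMonoidHom.id M
  have : Fact (Nat.Prime 3) := ⟨Nat.prime_three⟩
  have hne : (QuotientAddGroup.mk x : M ⧸ φ.range) ≠ 0 := by
    rw [Ne, QuotientAddGroup.eq_zero_iff]
    rintro ⟨z, hz⟩
    exact hx z hz.symm
  obtain ⟨j, hj⟩ := mem_multiples_of_prime_card (p := 3) (g := (x : M ⧸ φ.range))
    (g' := (y : M ⧸ φ.range)) hind hne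
  have hj' : ((j • x : M) : M ⧸ φ.range) = y := hj
  rw [QuotientAddGroup.eq] at hj'
  obtain ⟨z, hz⟩ := hj'
  refine ⟨j, z, ?_⟩
  have hz' : s z - z = -(j • x) + y := hz
  rw [hz']; abel

namespace NumberField

open NumberField.Units

variable {K : Type*} [Field K] [NumberField K]

theorem Units.eq_one_or_neg_one_of_eq_ratCast {u : (𝓞 K)ˣ} {q : ℚ}
    (h : ((u : 𝓞 K) : K) = algebraMap ℚ K q) : u = 1 ∨ u = -1 := by
  have h1 : IsIntegral ℤ (algebraMap ℚ K q) := h ▸ (u : 𝓞 K).2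
  have h2 : IsIntegral ℤ (algebraMap ℚ K q⁻¹) := by
    have : (((u⁻¹ : (𝓞 K)ˣ) : 𝓞 K) : K) = algebraMap ℚ K q⁻¹ := by
      rw [map_inv₀, ← h]
      apply eq_inv_of_mul_eq_one_left
      rw [← map_mul, Units.inv_mul, map_one]
    exact this ▸ ((u⁻¹ : (𝓞 K)ˣ) : 𝓞 K).2
  rw [isIntegral_algebraMap_iff (algebraMap ℚ K).injective] at h1 h2
  obtain ⟨a, ha⟩ := IsIntegrallyClosed.isIntegral_iff.1 h1
  obtain ⟨b, hb⟩ := IsIntegrallyClosed.isIntegral_iff.1 h2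
  have hq : q ≠ 0 := by
    rintro rfl
    rw [map_zero] at h
    have := RingOfIntegers.coe_injective (h.trans (map_zero _).symm)
    exact u.ne_zero this
  have hab : a * b = 1 := by
    have : ((a * b : ℤ) : ℚ) = 1 := by
      push_cast
      rw [show (a : ℚ) = q from ha, show (b : ℚ) = q⁻¹ from hb, mul_inv_cancel₀ hq]
    exact_mod_cast this
  rcases Int.isUnit_iff.1 (IsUnit.of_mul_eq_one b hab) with h3 | h3
  · left
    rw [← ha, h3] at h
    apply Units.ext
    apply RingOfIntegers.coe_injective
    exact h.trans (by simp)
  · right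
    rw [← ha, h3] at h
    apply Units.ext
    apply RingOfIntegers.coe_injective
    exact h.trans (by simp)

/-- The action of a field automorphism on the units. -/
noncomputable def unitsMap (σ : K ≃ₐ[ℚ] K) : (𝓞 K)ˣ →* (𝓞 K)ˣ :=
  Units.map (RingOfIntegers.mapRingHom (σ : K →+* K) : 𝓞 K →* 𝓞 K)

theorem coe_unitsMap (σ : K ≃ₐ[ℚ] K) (u : (𝓞 K)ˣ) :
    ((unitsMap σ u : 𝓞 K) : K) = σ ((u : 𝓞 K) : K) := rfl

/-- A unit outside `±(σ - 1)E` generates `E/±(σ - 1)E` in a cyclic cubic field. -/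
theorem exists_eq_pow_mul_of_cyclic_cubic (h3 : Module.finrank ℚ K = 3) (σ : K ≃ₐ[ℚ] K)
    (hσ3 : ∀ x, σ (σ (σ x)) = x)
    (hfix : ∀ x, σ x = x → ∃ q, algebraMap ℚ K q = x) {ξ : (𝓞 K)ˣ}
    (hξ : ∀ u : (𝓞 K)ˣ, ξ ≠ unitsMap σ u / u ∧ ξ ≠ -(unitsMap σ u / u)) (ε : (𝓞 K)ˣ) :
    ∃ (j : ℕ) (u : (𝓞 K)ˣ), ε = ξ ^ j * (unitsMap σ u / u) ∨ ε = -(ξ ^ j * (unitsMap σ u / u)) := by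
  have hodd : Odd (Module.finrank ℚ K) := by rw [h3]; decide
  have hpm : ∀ u : (𝓞 K)ˣ, u ∈ torsion K → u = 1 ∨ u = -1 := fun u hu ↦
    torsion_eq_one_or_neg_one_of_odd_finrank hodd ⟨u, hu⟩
  have hmem : ∀ u : (𝓞 K)ˣ, u = 1 ∨ u = -1 → u ∈ torsion K := by
    rintro u (rfl | rfl)
    · exact one_mem _
    · rw [torsion, CommGroup.mem_torsion, isOfFinOrder_iff_pow_eq_one]
      exact ⟨2, two_pos, by simp⟩
  have hle : torsion K ≤ (torsion K).comap (unitsMap σ) := by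
    intro u hu
    rw [Subgroup.mem_comap, torsion, CommGroup.mem_torsion]
    exact MonoidHom.isOfFinOrder _ ((CommGroup.mem_torsion _).1 hu)
  let s : Additive ((𝓞 K)ˣ ⧸ torsion K) →+ Additive ((𝓞 K)ˣ ⧸ torsion K) :=
    MonoidHom.toAdditive (QuotientGroup.map _ _ (unitsMap σ) hle)
  let π : (𝓞 K)ˣ → Additive ((𝓞 K)ˣ ⧸ torsion K) := fun u ↦ Additive.ofMul (QuotientGroup.mk u)
  have hπ : Function.Surjective π := fun x ↦ by
    obtain ⟨u, hu⟩ := QuotientGroup.mk_surjective x.toMul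
    exact ⟨u, by simp only [π, hu]; rfl⟩
  have hsπ : ∀ u, s (π u) = π (unitsMap σ u) := fun u ↦ rfl
  have hadd : ∀ u v, π u + π v = π (u * v) := fun u v ↦ rfl
  have hsub : ∀ u v, π u - π v = π (u / v) := fun u v ↦ rfl
  have hnsmul : ∀ (j : ℕ) u, j • π u = π (u ^ j) := fun j u ↦ rfl
  have heq : ∀ u v, π u = π v → u = v ∨ u = - v := by
    intro u v h
    have h' : (QuotientGroup.mk u : (𝓞 K)ˣ ⧸ torsion K) = QuotientGroup.mk v := h
    rw [QuotientGroup.eq] at h'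
    rcases hpm _ h' with h'' | h''
    · left; exact inv_mul_eq_one.1 h''
    · right
      rw [inv_mul_eq_iff_eq_mul] at h''
      rw [h'']; simp
  -- From `r₁ + 2r₂ = 3` and `r₁ ≥ 1` the unit rank is `1` or `2`, which is all that the lattice
  -- lemma asks for.
  have hrank := InfinitePlace.card_add_two_mul_card_eq_rank K
  rw [h3] at hrank
  have hr1 := InfinitePlace.nrRealPlaces_pos_of_odd_finrank hodd
  have hrk : rank K = InfinitePlace.nrRealPlaces K + InfinitePlace.nrComplexPlaces K - 1 := by
    rw [rank, InfinitePlace.card_eq_nrRealPlaces_add_nrComplexPlaces]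
  -- The norm of a unit is a rational unit, so `±1`, which is torsion.
  have hs : ∀ x, s (s x) + s x + x = 0 := by
    intro x
    obtain ⟨u, rfl⟩ := hπ x
    rw [hsπ, hsπ, hadd, hadd]
    set v := unitsMap σ (unitsMap σ u) * unitsMap σ u * u with hv
    have hvf : σ ((v : 𝓞 K) : K) = ((v : 𝓞 K) : K) := by
      rw [hv]
      simp only [Units.val_mul, map_mul, coe_unitsMap, hσ3]
      ring
    obtain ⟨q, hq⟩ := hfix _ hvf
    have := hmem v (Units.eq_one_or_neg_one_of_eq_ratCast hq.symm)
    exact (QuotientGroup.eq_one_iff v).2 this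
  obtain ⟨j, z, hz⟩ := AddMonoidHom.exists_nsmul_add_of_notMem_range
    (by rw [finrank_modTorsion, hrk]; omega) (by rw [finrank_modTorsion, hrk]; omega) s hs
    (x := π ξ) (fun z hz ↦ by
      obtain ⟨u, rfl⟩ := hπ z
      rw [hsπ, hsub] at hz
      rcases heq _ _ hz with h | h
      · exact (hξ u).1 h
      · exact (hξ u).2 h) (π ε)
  obtain ⟨u, rfl⟩ := hπ z
  rw [hsπ, hsub, hnsmul, hadd] at hz
  exact ⟨j, u, heq _ _ hz⟩

end NumberField

/-! ### Cubes of ideals and ideals of given norm. -/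

open NumberField

section DedekindDomain

variable {R : Type*} [CommRing R] [IsDedekindDomain R]

theorem Ideal.exists_pow_three_eq_of_mul_eq_pow {A B M : Ideal R} {k : ℕ} (hB : B ≠ ⊥)
    (hk : ¬ 3 ∣ k) (hcop : IsCoprime B M) (h : B ^ k * M = A ^ 3) : ∃ P : Ideal R, P ^ 3 = B := by
  let := UniqueFactorizationMonoid.toGCDMonoid (Ideal R)
  obtain ⟨D, hD⟩ := exists_eq_pow_of_mul_eq_pow_of_coprime (hcop.pow_left (m := k)) h
  have key : ∀ (q : ℕ) (D : Ideal R), B ^ (3 * q + 1) = D ^ 3 → ∃ P : Ideal R, P ^ 3 = B := by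
    intro q D hD
    have hdvd : (B ^ q) ^ 3 ∣ D ^ 3 := ⟨B, by rw [← hD, ← pow_mul, pow_succ, mul_comm q]⟩
    obtain ⟨E, rfl⟩ := (UniqueFactorizationMonoid.pow_dvd_pow_iff_dvd three_ne_zero).1 hdvd
    refine ⟨E, mul_left_cancel₀ (pow_ne_zero (3 * q) hB) ?_⟩
    rw [← pow_succ, hD, mul_pow, ← pow_mul, mul_comm q]
  obtain h1 | h2 : k % 3 = 1 ∨ k % 3 = 2 := by omega
  · exact key (k / 3) D (by rw [← hD]; congr 1; omega)
  -- Squaring turns an exponent `≡ 2` into one `≡ 1` mod `3`.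
  · refine key (2 * k / 3) (D ^ 2) ?_
    rw [pow_right_comm, ← hD, ← pow_mul]; congr 1; omega

/-- If `z³ = bᵏ w` with `b` and `w` coprime and `3 ∤ k`, then `(b)` is the cube of an ideal. -/
theorem Ideal.exists_pow_three_eq_span {b w z : R} {k : ℕ} (hb : b ≠ 0) (hk : ¬ 3 ∣ k)
    (hcop : IsCoprime b w) (h : z ^ 3 = b ^ k * w) : ∃ P : Ideal R, P ^ 3 = Ideal.span {b} := by
  refine Ideal.exists_pow_three_eq_of_mul_eq_pow (A := Ideal.span {z}) (M := Ideal.span {w})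
    (k := k) (by simpa using hb) hk ?_ ?_
  · rwa [Ideal.isCoprime_span_singleton_iff]
  · simp only [Ideal.span_singleton_pow, Ideal.span_singleton_mul_span_singleton, h]

end DedekindDomain

section absNorm

theorem Ideal.IsPrime.exists_prime_natCast_mem {R : Type*} [CommRing R] {Q : Ideal R}
    (hQ : Q.IsPrime) {n : ℕ} (hn : n ≠ 0) (h : (n : R) ∈ Q) :
    ∃ p : ℕ, p.Prime ∧ p ∣ n ∧ (p : R) ∈ Q := by
  induction n using Nat.recOnMul with
  | zero => exact absurd rfl hn
  | one => exact absurd (by simpa using h) ((Ideal.ne_top_iff_one Q).1 hQ.ne_top)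
  | prime p hp => exact ⟨p, hp, dvd_rfl, h⟩
  | mul a b iha ihb =>
    rw [Nat.cast_mul] at h
    rcases hQ.mem_or_mem h with h | h
    · obtain ⟨p, hp, hd, hm⟩ := iha (left_ne_zero_of_mul hn) h
      exact ⟨p, hp, hd.mul_right b, hm⟩
    · obtain ⟨p, hp, hd, hm⟩ := ihb (right_ne_zero_of_mul hn) h
      exact ⟨p, hp, hd.mul_left a, hm⟩

variable {K : Type*} [Field K]

theorem Ideal.exists_pow_three_eq_span_natCast {c : ℕ} (hc : c ≠ 0)
    (h : ∀ p : ℕ, p.Prime → p ∣ c → ∃ P : Ideal (𝓞 K), P ^ 3 = Ideal.span {(p : 𝓞 K)}) :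
    ∃ C : Ideal (𝓞 K), C ^ 3 = Ideal.span {(c : 𝓞 K)} := by
  induction c using Nat.recOnMul with
  | zero => exact absurd rfl hc
  | one => exact ⟨⊤, by simp⟩
  | prime p hp => exact h p hp dvd_rfl
  | mul a b iha ihb =>
    obtain ⟨A, hA⟩ := iha (left_ne_zero_of_mul hc) fun p hp hd ↦ h p hp (hd.mul_right b)
    obtain ⟨B, hB⟩ := ihb (right_ne_zero_of_mul hc) fun p hp hd ↦ h p hp (hd.mul_left a)
    exact ⟨A * B, by rw [mul_pow, hA, hB, Ideal.span_singleton_mul_span_singleton, Nat.cast_mul]⟩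

variable [NumberField K] (h3 : Module.finrank ℚ K = 3)
include h3

theorem Ideal.absNorm_span_natCast_of_cubic (n : ℕ) :
    Ideal.absNorm (Ideal.span {(n : 𝓞 K)}) = n ^ 3 := by
  rw [Ideal.absNorm_span_natCast, RingOfIntegers.rank, h3]

/-- A prime factor `Q` of `I` lies over some `p` with `(p) = P³`. As `P` has prime norm `p`, it
equals `Q`, so `Q³` is generated by its own norm. -/
theorem Ideal.pow_three_eq_span_absNorm {I : Ideal (𝓞 K)} (hI : I ≠ ⊥)
    (h : ∀ p : ℕ, p.Prime → p ∣ Ideal.absNorm I →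
      ∃ P : Ideal (𝓞 K), P ^ 3 = Ideal.span {(p : 𝓞 K)}) :
    I ^ 3 = Ideal.span {(Ideal.absNorm I : 𝓞 K)} := by
  induction I using UniqueFactorizationMonoid.induction_on_prime with
  | h₁ => exact absurd rfl hI
  | h₂ x hx =>
    rw [Ideal.isUnit_iff] at hx
    simp [hx]
  | h₃ I Q hI0 hQ ih =>
    rw [map_mul] at h ⊢
    have hI' := ih hI0 fun p hp hd ↦ h p hp (hd.mul_left _)
    have hQ1 : Ideal.absNorm Q ≠ 1 := fun h1 ↦ hQ.not_isUnit (by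
      rw [Ideal.isUnit_iff]; exact Ideal.absNorm_eq_one_iff.1 h1)
    have hne : Ideal.absNorm Q ≠ 0 := by
      rw [Ne, Ideal.absNorm_eq_zero_iff]; exact hQ.ne_zero
    obtain ⟨p, hp, hpQ, hmem⟩ :=
      (Ideal.isPrime_of_prime hQ).exists_prime_natCast_mem hne (Ideal.absNorm_mem Q)
    obtain ⟨P, hP⟩ := h p hp (hpQ.mul_right _)
    have hPn : Ideal.absNorm P = p := by
      have := congrArg Ideal.absNorm hP
      rw [map_pow, Ideal.absNorm_span_natCast_of_cubic h3] at this
      exact Nat.pow_left_injective three_ne_zero this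
    have hQP : Q ∣ P := by
      apply hQ.dvd_of_dvd_pow (n := 3)
      rw [hP, Ideal.dvd_span_singleton]
      exact hmem
    obtain ⟨S, rfl⟩ := hQP
    rw [map_mul] at hPn
    have hSn : Ideal.absNorm S = 1 := by
      rcases (Nat.dvd_prime hp).1 (hPn ▸ dvd_mul_right (Ideal.absNorm Q) _) with h4 | h4
      · exact absurd h4 hQ1
      · rw [h4] at hPn
        exact Nat.eq_of_mul_eq_mul_left hp.pos (hPn.trans (mul_one p).symm)
    rw [hSn, mul_one] at hPn
    rw [Ideal.absNorm_eq_one_iff.1 hSn, Ideal.mul_top] at hP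
    rw [mul_pow, hI', hP, hPn, Ideal.span_singleton_mul_span_singleton, Nat.cast_mul]

theorem Ideal.absNorm_eq_iff_pow_three_eq {c : ℕ} (hc : c ≠ 0)
    (h : ∀ p : ℕ, p.Prime → p ∣ c → ∃ P : Ideal (𝓞 K), P ^ 3 = Ideal.span {(p : 𝓞 K)})
    {I : Ideal (𝓞 K)} : Ideal.absNorm I = c ↔ I ^ 3 = Ideal.span {(c : 𝓞 K)} := by
  constructor
  · rintro rfl
    exact Ideal.pow_three_eq_span_absNorm h3 (fun h0 ↦ hc (by simp [h0])) h
  · intro hI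
    have := congrArg Ideal.absNorm hI
    rw [map_pow, Ideal.absNorm_span_natCast_of_cubic h3] at this
    exact Nat.pow_left_injective three_ne_zero this

end absNorm

/-! ### Ramification in cyclotomic fields. -/

section Cyclotomic

variable {L : Type*} [Field L] [NumberField L]

/-- If `(p)` is a cube, `3` divides the ramification index of `p`, which is `p^(a-1)(p - 1)` for `a
= v_p(m) ≥ 1` and `1` for `a = 0`. So `a ≥ 1`, and `a ≥ 2` when `p = 3`. -/
theorem IsCyclotomicExtension.Rat.dvd_of_pow_three_eq_span {m : ℕ} [NeZero m]
    [IsCyclotomicExtension {m} ℚ L] {p : ℕ} (hp : p.Prime) {I : Ideal (𝓞 L)}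
    (hI : I ^ 3 = Ideal.span {(p : 𝓞 L)}) : (if p = 3 then 9 else p) ∣ m := by
  have : Fact p.Prime := ⟨hp⟩
  have hmap : (Ideal.span {(p : ℤ)}).map (algebraMap ℤ (𝓞 L)) = I ^ 3 := by
    rw [hI, Ideal.map_span]; simp
  have h0 : (Ideal.span {(p : ℤ)}).map (algebraMap ℤ (𝓞 L)) ≠ ⊥ := by
    rw [hmap, hI]; simpa using hp.ne_zero
  have hpm : (Ideal.span {(p : ℤ)}).IsMaximal :=
    Int.ideal_span_isMaximal_of_prime p
  obtain ⟨⟨P, hP, hP'⟩⟩ := (Ideal.span {(p : ℤ)}).nonempty_primesOver (S := 𝓞 L)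
  have hram := Ideal.IsDedekindDomain.ramificationIdx_eq_normalizedFactors_count (Ideal.span {(p : ℤ)}) P h0
  rw [hmap, UniqueFactorizationMonoid.normalizedFactors_pow, Multiset.count_nsmul] at hram
  have hdvd : 3 ∣ Ideal.ramificationIdx P ℤ := ⟨_, hram⟩
  obtain ⟨a, m', hm', hm⟩ := Nat.exists_eq_pow_mul_and_not_dvd (NeZero.ne m) p hp.ne_one
  rcases a with _ | k
  · have hpm' : ¬ p ∣ m := by rwa [hm, pow_zero, one_mul]
    rw [IsCyclotomicExtension.Rat.ramificationIdx_eq_of_not_dvd (m := m) p L P hpm'] at hdvd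
    norm_num at hdvd
  · rw [IsCyclotomicExtension.Rat.ramificationIdx_eq m L P hm hm'] at hdvd
    split_ifs with h
    · subst h
      rcases k with _ | k
      · norm_num at hdvd
      · rw [hm]
        exact Dvd.dvd.mul_right (pow_dvd_pow 3 (by omega : 2 ≤ k + 1 + 1)) _
    · rw [hm, pow_succ']
      exact Dvd.dvd.mul_right (dvd_mul_right _ _) _

end Cyclotomic

/-! ### Principality and rational cubes `c Δ_t ^ j`. -/

namespace SimplestCubic

section Ring

variable {A : Type*} [CommRing A] {t : ℤ} {x : A}

theorem root_mul_eq_one (hx : x ^ 3 - t * x ^ 2 - (t + 3) * x - 1 = 0) :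
    x * (x ^ 2 - t * x - (t + 3)) = 1 := by
  linear_combination hx

theorem one_add_root_mul_eq_one (hx : x ^ 3 - t * x ^ 2 - (t + 3) * x - 1 = 0) :
    (1 + x) * -(x ^ 2 - (t + 1) * x - 2) = 1 := by
  linear_combination -hx

/-- Both `x` and `1 + x` are units, so the ideal generated by `Δ_t` is the cube of a principal ideal
with an explicit generator. -/
theorem pow_three_eq_Delta_mul (hx : x ^ 3 - t * x ^ 2 - (t + 3) * x - 1 = 0) :
    (x ^ 2 + x + 1) ^ 3 = Delta t * (x * (1 + x)) ^ 2 := by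
  simp only [Delta]
  push_cast
  linear_combination (x ^ 3 + (t + 3) * x ^ 2 + t * x - 1) * hx

end Ring

theorem pow_three_injective {R : Type*} [CommRing R] [IsDedekindDomain R] {I J : Ideal R}
    (h : I ^ 3 = J ^ 3) : I = J :=
  dvd_antisymm ((UniqueFactorizationMonoid.pow_dvd_pow_iff_dvd three_ne_zero).1 h.dvd)
    ((UniqueFactorizationMonoid.pow_dvd_pow_iff_dvd three_ne_zero).1 h.symm.dvd)

variable {K : Type*} [Field K] [NumberField K] {t : ℤ}

/-- With `γ = Θ² + Θ + 1`, the ideals `(γ^j)` and `C · (n)` have the same cube, hence agree; then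
`n` divides `γ^j` and the quotient generates `C`. -/
theorem isPrincipal_of_mul_pow_three_eq {Θ : 𝓞 K}
    (hΘ : Θ ^ 3 - t * Θ ^ 2 - (t + 3) * Θ - 1 = 0) {c n j : ℕ} (hn : n ≠ 0)
    (h : (c * n ^ 3 : ℤ) = Delta t ^ j) {C : Ideal (𝓞 K)} (hC : C ^ 3 = Ideal.span {(c : 𝓞 K)}) :
    C.IsPrincipal := by
  set γ := Θ ^ 2 + Θ + 1
  have hγ := pow_three_eq_Delta_mul hΘ
  have hu : IsUnit ((Θ * (1 + Θ)) ^ 2) :=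
    ((IsUnit.of_mul_eq_one _ (root_mul_eq_one hΘ)).mul
      (IsUnit.of_mul_eq_one _ (one_add_root_mul_eq_one hΘ))).pow 2
  have h1 : Ideal.span {γ ^ j} = C * Ideal.span {(n : 𝓞 K)} := by
    apply pow_three_injective
    rw [mul_pow, hC, Ideal.span_singleton_pow, Ideal.span_singleton_pow,
      Ideal.span_singleton_mul_span_singleton, pow_right_comm, hγ, mul_pow,
      Ideal.span_singleton_mul_right_unit (hu.pow j)]
    congr 2
    have := congrArg (Int.cast : ℤ → 𝓞 K) h
    push_cast at this
    exact this.symm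
  have h2 : γ ^ j ∈ Ideal.span {(n : 𝓞 K)} := by
    have : γ ^ j ∈ Ideal.span {γ ^ j} := Ideal.mem_span_singleton_self _
    rw [h1] at this
    exact Ideal.mul_le_right this
  obtain ⟨a, ha⟩ := Ideal.mem_span_singleton.1 h2
  refine ⟨a, ?_⟩
  have hn0 : Ideal.span {(n : 𝓞 K)} ≠ ⊥ := by simpa using hn
  apply mul_right_cancel₀ hn0
  rw [← h1, ha, mul_comm (n : 𝓞 K), ← Ideal.span_singleton_mul_span_singleton]

/-- As `σ³ = 1`, the sign `-1` is impossible, so `w` is rational. Then `η` is a rational unit, and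
its sign is absorbed in the cube. -/
theorem exists_ratCast_pow_three_eq {σ : K ≃ₐ[ℚ] K} (hσ3 : ∀ x, σ (σ (σ x)) = x)
    (hfix : ∀ x, σ x = x → ∃ q, algebraMap ℚ K q = x) {w : K} (hw0 : w ≠ 0)
    (hw : σ w = w ∨ σ w = -w) {η : (𝓞 K)ˣ} {n : ℚ}
    (h : w ^ 3 = ((η : 𝓞 K) : K) * algebraMap ℚ K n) : ∃ r : ℚ, r ^ 3 = n := by
  have hfw : σ w = w := by
    rcases hw with hw | hw
    · exact hw
    · exfalso
      have := hσ3 w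
      rw [hw, map_neg, hw, neg_neg, hw] at this
      exact hw0 (self_eq_neg.1 this.symm)
  obtain ⟨q, rfl⟩ := hfix w hfw
  have hn : n ≠ 0 := by
    rintro rfl
    rw [map_zero, mul_zero] at h
    exact hw0 (pow_eq_zero_iff three_ne_zero |>.1 h)
  have hη : ((η : 𝓞 K) : K) = algebraMap ℚ K (q ^ 3 / n) := by
    rw [map_div₀, map_pow, h, mul_div_cancel_right₀]
    simpa using hn
  rcases Units.eq_one_or_neg_one_of_eq_ratCast hη with h1 | h1
  · rw [h1] at h
    refine ⟨q, (algebraMap ℚ K).injective ?_⟩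
    rw [map_pow, h]
    simp
  · rw [h1] at h
    refine ⟨-q, (algebraMap ℚ K).injective ?_⟩
    rw [map_pow, map_neg, Odd.neg_pow (by decide), h]
    simp

/-- The ideals of `α` and `σα` both have cube `(c)`, and cube roots of ideals are unique. -/
theorem exists_unit_mul_eq_map {σ : K ≃ₐ[ℚ] K} {α : 𝓞 K} {ε : (𝓞 K)ˣ} {c : ℕ}
    (hα : α ^ 3 = ε * c) : ∃ μ : (𝓞 K)ˣ, σ (α : K) = ((μ : 𝓞 K) : K) * α := by
  set α' : 𝓞 K := RingOfIntegers.mapRingHom (σ : K →+* K) α with hα'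
  have h1 : α' ^ 3 = unitsMap σ ε * c := by
    rw [hα', ← map_pow, hα, map_mul, map_natCast]; rfl
  have h2 : Associated α α' := by
    rw [← Ideal.span_singleton_eq_span_singleton]
    apply pow_three_injective
    rw [Ideal.span_singleton_pow, Ideal.span_singleton_pow, h1, hα,
      Ideal.span_singleton_mul_left_unit ε.isUnit,
      Ideal.span_singleton_mul_left_unit (unitsMap σ ε).isUnit]
  obtain ⟨μ, hμ⟩ := h2
  refine ⟨μ, ?_⟩
  have := congrArg (algebraMap (𝓞 K) K) hμ
  rw [map_mul, mul_comm] at this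
  exact this.symm

theorem exists_pow_three_eq_mul_Delta_pow (h3 : Module.finrank ℚ K = 3) {σ : K ≃ₐ[ℚ] K}
    (hσ3 : ∀ x, σ (σ (σ x)) = x) (hfix : ∀ x, σ x = x → ∃ q, algebraMap ℚ K q = x) {Θ : 𝓞 K}
    (hΘ : Θ ^ 3 - t * Θ ^ 2 - (t + 3) * Θ - 1 = 0) (hσ : σ (Θ : K) = -1 / (1 + (Θ : K)))
    (hcube : ∀ r : ℚ, r ^ 3 ≠ Delta t) {c : ℕ} (hc : c ≠ 0) {C : Ideal (𝓞 K)}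
    (hC : C ^ 3 = Ideal.span {(c : 𝓞 K)}) (hp : C.IsPrincipal) :
    ∃ (j : ℕ) (r : ℚ), r ^ 3 = c * Delta t ^ j := by
  obtain ⟨α, rfl⟩ := hp
  have hcK : (c : 𝓞 K) ≠ 0 := by exact_mod_cast hc
  obtain ⟨ε, hε⟩ : ∃ ε : (𝓞 K)ˣ, α ^ 3 = ε * c := by
    change Ideal.span {α} ^ 3 = _ at hC
    rw [Ideal.span_singleton_pow, Ideal.span_singleton_eq_span_singleton] at hC
    obtain ⟨u, hu⟩ := hC.symm
    exact ⟨u, by rw [← hu, mul_comm]⟩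
  have hα0 : α ≠ 0 := by
    rintro rfl
    rw [zero_pow three_ne_zero] at hε
    exact mul_ne_zero ε.ne_zero hcK hε.symm
  obtain ⟨μ, hμ⟩ := exists_unit_mul_eq_map (σ := σ) hε
  set θ : K := (Θ : K) with hθdef
  have hθ : θ ^ 3 - t * θ ^ 2 - (t + 3) * θ - 1 = 0 := by
    have := congrArg (algebraMap (𝓞 K) K) hΘ
    simpa only [map_sub, map_mul, map_pow, map_add, map_intCast, map_ofNat, map_one,
      map_zero] using this
  have hθ0 := ne_zero_of_root hθ
  have hθ1 := one_add_ne_zero_of_root hθ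
  obtain ⟨ξ, hξ⟩ : ∃ ξ : (𝓞 K)ˣ, (ξ : 𝓞 K) = Θ := IsUnit.of_mul_eq_one _ (root_mul_eq_one hΘ)
  obtain ⟨ξ', hξ'⟩ : ∃ ξ' : (𝓞 K)ˣ, (ξ' : 𝓞 K) = 1 + Θ :=
    IsUnit.of_mul_eq_one _ (one_add_root_mul_eq_one hΘ)
  have hξK : ((ξ : 𝓞 K) : K) = θ := by rw [hξ]
  have hξK' : ((ξ' : 𝓞 K) : K) = 1 + θ := by rw [hξ']; simp [hθdef]
  -- Chosen so that `σβ/β = θ⁻¹`, while `β³` is still a unit times `Δ_t`.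
  set β : K := (θ ^ 2 + θ + 1) / (1 + θ) with hβ
  have hσβ : σ β = β / θ := by
    have h4 : (1 : K) + -1 / (1 + θ) = θ / (1 + θ) := by field_simp; ring
    rw [hβ]
    simp only [map_div₀, map_add, map_pow, map_one, hσ]
    rw [h4]
    field_simp
    ring
  have hmul : ∀ u v : (𝓞 K)ˣ, (((u * v : (𝓞 K)ˣ) : 𝓞 K) : K) =
      ((u : 𝓞 K) : K) * ((v : 𝓞 K) : K) := fun u v ↦ map_mul (algebraMap (𝓞 K) K) _ _
  have hpow : ∀ (u : (𝓞 K)ˣ) (j : ℕ), (((u ^ j : (𝓞 K)ˣ) : 𝓞 K) : K) =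
      ((u : 𝓞 K) : K) ^ j := fun u j ↦ by
    rw [Units.val_pow_eq_pow_val]; exact map_pow (algebraMap (𝓞 K) K) _ _
  have hneg : ∀ u : (𝓞 K)ˣ, (((-u : (𝓞 K)ˣ) : 𝓞 K) : K) = -((u : 𝓞 K) : K) := fun u ↦
    map_neg (algebraMap (𝓞 K) K) _
  have hβ3 : β ^ 3 = (((ξ ^ 2 * ξ'⁻¹ : (𝓞 K)ˣ) : 𝓞 K) : K) * algebraMap ℚ K (Delta t) := by
    have h5 := pow_three_eq_Delta_mul hθ
    have h6 : ((((ξ'⁻¹ : (𝓞 K)ˣ)) : 𝓞 K) : K) = (1 + θ)⁻¹ := by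
      rw [← hξK']
      apply eq_inv_of_mul_eq_one_left
      rw [← map_mul, Units.inv_mul, map_one]
    rw [hmul, hpow, hξK, h6, hβ, div_pow, h5]
    rw [map_intCast]
    field_simp
  have hΔ : (Delta t : K) ≠ 0 := by exact_mod_cast (Delta_pos t).ne'
  have hβ0 : β ≠ 0 := by
    intro h0
    rw [h0, zero_pow three_ne_zero, map_intCast] at hβ3
    refine mul_ne_zero ?_ hΔ hβ3.symm
    simp
  have hcoe : ∀ u : (𝓞 K)ˣ, ((u : 𝓞 K) : K) ≠ 0 := fun u ↦ by simp
  have hdiv : ∀ u v : (𝓞 K)ˣ, (((u / v : (𝓞 K)ˣ) : 𝓞 K) : K) =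
      ((u : 𝓞 K) : K) / ((v : 𝓞 K) : K) := fun u v ↦ by
    rw [eq_div_iff (hcoe v), ← map_mul, ← Units.val_mul, div_mul_cancel]
  -- If `θ = ±σu/u`, then `σ` fixes `βu` up to sign, and its cube, a unit times `Δ_t`, would make
  -- `Δ_t` a rational cube.
  obtain ⟨j, u, hju⟩ := exists_eq_pow_mul_of_cyclic_cubic h3 σ hσ3 hfix (ξ := ξ) (by
    intro u
    rw [← not_or]
    intro hu
    have hσu : σ ((u : 𝓞 K) : K) = θ * ((u : 𝓞 K) : K) ∨
        σ ((u : 𝓞 K) : K) = -(θ * ((u : 𝓞 K) : K)) := by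
      rw [← coe_unitsMap, ← hξK]
      rcases hu with hu | hu
      · left
        rw [hu, hdiv, div_mul_cancel₀ _ (hcoe u)]
      · right
        rw [hu, hneg, hdiv, neg_mul, neg_neg, div_mul_cancel₀ _ (hcoe u)]
    obtain ⟨r, hr⟩ := exists_ratCast_pow_three_eq hσ3 hfix (w := β * ((u : 𝓞 K) : K))
      (η := ξ ^ 2 * ξ'⁻¹ * u ^ 3) (n := Delta t) (mul_ne_zero hβ0 (hcoe u)) (by
        rw [map_mul, hσβ]
        rcases hσu with h | h
        · left; rw [h]; field_simp
        · right; rw [h]; field_simp) (by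
        rw [mul_pow, hβ3, hmul (ξ ^ 2 * ξ'⁻¹), hpow u]
        ring)
    exact hcube r hr) μ
  have hσα : σ (α : K) = θ ^ j * (σ ((u : 𝓞 K) : K) / ((u : 𝓞 K) : K)) * α ∨
      σ (α : K) = -(θ ^ j * (σ ((u : 𝓞 K) : K) / ((u : 𝓞 K) : K)) * α) := by
    rw [hμ, ← coe_unitsMap, ← hdiv, ← hξK]
    rcases hju with h | h
    · left
      rw [h, hmul, hpow]
    · right
      rw [h, hneg, hmul, hpow, neg_mul]
  have hα0' : (α : K) ≠ 0 := by simpa using hα0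
  have hσu0 : σ ((u : 𝓞 K) : K) ≠ 0 := by simp
  -- In `αβ^j/u` the factors `θ^j` and `σu/u` of `σα/α` both cancel.
  obtain ⟨r, hr⟩ := exists_ratCast_pow_three_eq hσ3 hfix
    (w := (α : K) * β ^ j / ((u : 𝓞 K) : K))
    (η := ε * (ξ ^ 2 * ξ'⁻¹) ^ j / u ^ 3) (n := c * Delta t ^ j)
    (div_ne_zero (mul_ne_zero hα0' (pow_ne_zero j hβ0)) (hcoe u)) (by
      rw [map_div₀, map_mul, map_pow, hσβ, div_pow]
      rcases hσα with h | h
      · left; rw [h]; field_simp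
      · right; rw [h]; field_simp) (by
      have hα3 : (α : K) ^ 3 = ((ε : 𝓞 K) : K) * c := by
        rw [← map_pow, hε, map_mul, map_natCast]
      rw [div_pow, mul_pow, pow_right_comm β, hβ3, hα3, hdiv, hmul ε, hpow (ξ ^ 2 * ξ'⁻¹),
        hpow u]
      simp only [map_mul, map_pow, map_natCast]
      ring)
  exact ⟨j, r, hr⟩

end SimplestCubic

/-! ### The Galois group, and total ramification at the primes of the explicit conductor. -/

namespace SimplestCubic

section Galois

variable {K : Type*} [Field K] [Algebra ℚ K] [FiniteDimensional ℚ K] {t : ℤ}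

/-- The field generated by a root of Shanks' cubic is cyclic. -/
theorem exists_algEquiv (pb : PowerBasis ℚ K) (h3 : Module.finrank ℚ K = 3)
    (hθ : pb.gen ^ 3 - t * pb.gen ^ 2 - (t + 3) * pb.gen - 1 = 0) :
    ∃ σ : K ≃ₐ[ℚ] K, σ pb.gen = -1 / (1 + pb.gen) ∧ (∀ x, σ (σ (σ x)) = x) ∧
      ∀ x, σ x = x → ∃ q, algebraMap ℚ K q = x := by
  have : CharZero K := algebraRat.charZero K
  set θ := pb.gen with hθdef
  have h0 := ne_zero_of_root hθ
  have h1 := one_add_ne_zero_of_root hθ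
  have hmin : (minpoly ℚ θ).natDegree = 3 := by
    rw [hθdef, ← pb.finrank.trans pb.natDegree_minpoly.symm, h3]
  have hpoly : minpoly ℚ θ = Polynomial.X ^ 3 - Polynomial.C (t : ℚ) * Polynomial.X ^ 2
      - Polynomial.C (t + 3 : ℚ) * Polynomial.X - 1 := by
    symm
    apply minpoly.unique ℚ θ
    · monicity!
    · simpa only [map_sub, map_mul, map_pow, Polynomial.aeval_X, Polynomial.aeval_C, map_one,
        map_add, map_intCast, map_ofNat] using hθ
    · intro q hq hq0
      have h4 := minpoly.min ℚ θ hq hq0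
      rw [Polynomial.degree_eq_natDegree (minpoly.ne_zero pb.isIntegral_gen), hmin] at h4
      refine le_trans ?_ h4
      compute_degree
      exact le_rfl
  have hroot : Polynomial.aeval (-1 / (1 + θ)) (minpoly ℚ θ) = 0 := by
    simp only [hpoly, map_sub, map_mul, map_pow, Polynomial.aeval_X, map_one, map_add,
      map_intCast, map_ofNat]
    field_simp
    linear_combination (-1 : K) * hθ
  set φ := pb.lift (-1 / (1 + θ)) hroot
  have hφ : φ θ = -1 / (1 + θ) := pb.lift_gen _ hroot
  have hφ2 : φ (φ θ) = -(1 + θ) / θ := by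
    have h4 : (1 : K) + -1 / (1 + θ) = θ / (1 + θ) := by field_simp; ring
    rw [hφ]
    simp only [map_div₀, map_add, map_neg, map_one, hφ]
    rw [h4]
    field_simp
  have hφ3 : φ (φ (φ θ)) = θ := by
    have h4 : (1 : K) + -1 / (1 + θ) = θ / (1 + θ) := by field_simp; ring
    rw [hφ2]
    simp only [map_div₀, map_add, map_neg, map_one, hφ]
    rw [h4]
    field_simp
  have hφ3' : ∀ x, φ (φ (φ x)) = x := by
    have : (φ.comp φ).comp φ = AlgHom.id ℚ K := pb.algHom_ext hφ3
    exact fun x ↦ DFunLike.congr_fun this x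
  set σ : K ≃ₐ[ℚ] K := AlgEquiv.ofAlgHom φ (φ.comp φ) (AlgHom.ext hφ3') (AlgHom.ext hφ3')
  have hσφ : ∀ x, σ x = φ x := fun x ↦ rfl
  refine ⟨σ, hφ, hφ3', ?_⟩
  have hord : orderOf σ = 3 := by
    have : Fact (Nat.Prime 3) := ⟨Nat.prime_three⟩
    apply orderOf_eq_prime
    · ext x
      exact hφ3' x
    -- A trivial `σ` would give `θ² + θ + 1 = 0`, and the cubic identity would then make `Δ_t`
    -- vanish.
    · intro h
      have h4 : φ θ = θ := by rw [← hσφ, h]; rfl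
      rw [hφ, div_eq_iff h1] at h4
      have h5 := pow_three_eq_Delta_mul hθ
      rw [show θ ^ 2 + θ + 1 = 0 by linear_combination -h4, zero_pow three_ne_zero] at h5
      have hΔ : (Delta t : K) ≠ 0 := by exact_mod_cast (Delta_pos t).ne'
      exact mul_ne_zero hΔ (pow_ne_zero 2 (mul_ne_zero h0 h1)) h5.symm
  set H := Subgroup.zpowers σ
  have hcard := IntermediateField.finrank_fixedField_eq_card H
  rw [Nat.card_zpowers, hord] at hcard
  have hmul := Module.finrank_mul_finrank ℚ (IntermediateField.fixedField H) K
  rw [hcard, h3] at hmul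
  have hbot : IntermediateField.fixedField H = ⊥ :=
    IntermediateField.finrank_eq_one_iff.1 (by omega)
  intro x hx
  have hmem : x ∈ IntermediateField.fixedField H := by
    rw [IntermediateField.mem_fixedField_iff]
    intro g hg
    have hle : H ≤ MulAction.stabilizer (K ≃ₐ[ℚ] K) x := by
      rw [Subgroup.zpowers_le]; exact hx
    exact hle hg
  rw [hbot, IntermediateField.mem_bot] at hmem
  exact hmem

end Galois

/-- A rational root is an integer dividing `1`, but `f_t(1) = -2t - 3` is odd and `f_t(-1) = 1`. -/
theorem no_rational_root (t : ℤ) (z : ℚ) : z ^ 3 - t * z ^ 2 - (t + 3) * z - 1 ≠ 0 := by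
  intro h
  obtain ⟨n, hn⟩ : ∃ n : ℤ, (n : ℚ) = z := by
    have hint : IsIntegral ℤ z := by
      refine ⟨shanksPoly t, ?_, ?_⟩
      · unfold shanksPoly; monicity!
      · rw [← Polynomial.aeval_def, aeval_shanksPoly]; exact h
    exact IsIntegrallyClosed.isIntegral_iff.1 hint
  rw [← hn] at h
  have h' : n ^ 3 - t * n ^ 2 - (t + 3) * n - 1 = 0 := by exact_mod_cast h
  have h1 := root_mul_eq_one (A := ℤ) (by simpa using h')
  rcases Int.isUnit_iff.1 (IsUnit.of_mul_eq_one _ h1) with h2 | h2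
  · rw [h2] at h'; omega
  · rw [h2] at h'; omega

section Ramification

variable {K : Type*} [Field K] [NumberField K] {t : ℤ} {Θ : 𝓞 K}

theorem exists_pow_three_eq_span_of_Delta (hΘ : Θ ^ 3 - t * Θ ^ 2 - (t + 3) * Θ - 1 = 0) {p : ℕ}
    (hp : p.Prime) (hv : ¬ 3 ∣ padicValInt p (Delta t)) :
    ∃ P : Ideal (𝓞 K), P ^ 3 = Ideal.span {(p : 𝓞 K)} := by
  have : Fact p.Prime := ⟨hp⟩
  have hu : IsUnit ((Θ * (1 + Θ)) ^ 2) :=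
    ((IsUnit.of_mul_eq_one _ (root_mul_eq_one hΘ)).mul
      (IsUnit.of_mul_eq_one _ (one_add_root_mul_eq_one hΘ))).pow 2
  obtain ⟨w, hw⟩ := padicValInt_dvd (p := p) (Delta t)
  have hpw : ¬ (p : ℤ) ∣ w := by
    rintro ⟨w', rfl⟩
    have h1 : (p : ℤ) ^ (padicValInt p (Delta t) + 1) ∣ Delta t := 
      ⟨w', by rw [pow_succ, mul_assoc]; exact hw⟩
    have := ((padicValInt_dvd_iff _ _).1 h1).resolve_left (Delta_pos t).ne'
    omega
  have hcop : IsCoprime (p : ℤ) w :=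
    (Irreducible.coprime_iff_not_dvd (Nat.prime_iff_prime_int.1 hp).irreducible).2 hpw
  refine Ideal.exists_pow_three_eq_span (z := Θ ^ 2 + Θ + 1) (k := padicValInt p (Delta t))
    (w := w * (Θ * (1 + Θ)) ^ 2) (by exact_mod_cast hp.ne_zero) hv ?_ ?_
  · have h2 : IsCoprime (p : 𝓞 K) (w : 𝓞 K) := by
      have := hcop.map (Int.castRingHom (𝓞 K))
      simpa using this
    exact (isCoprime_mul_unit_right_right hu _ _).2 h2
  · rw [pow_three_eq_Delta_mul hΘ, ← mul_assoc]
    congr 1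
    have := congrArg (Int.cast : ℤ → 𝓞 K) hw
    rw [this]
    push_cast
    rfl

/-- Here `v_3(Δ_t) = 3`, so `Θ² + Θ + 1` carries no information at `3`. The shifted root `z = Θ - 1`
satisfies `z³ = 9w` instead, with `w` coprime to `3`. -/
theorem exists_pow_three_eq_span_three (hΘ : Θ ^ 3 - t * Θ ^ 2 - (t + 3) * Θ - 1 = 0) {r : ℤ}
    (ht : t = 3 + 9 * r) (hr : ¬ 3 ∣ 1 + 2 * r) :
    ∃ P : Ideal (𝓞 K), P ^ 3 = Ideal.span {(3 : 𝓞 K)} := by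
  set z := Θ - 1 with hz
  set w : 𝓞 K := r * z ^ 2 + (1 + 3 * r) * z + (1 + 2 * r) with hw
  have hz3 : z ^ 3 = 3 ^ 2 * w := by
    have ht' : (t : 𝓞 K) = 3 + 9 * r := by rw [ht]; push_cast; ring
    rw [hw, hz]
    rw [ht'] at hΘ
    linear_combination hΘ
  refine Ideal.exists_pow_three_eq_span (b := (3 : 𝓞 K)) (z := z) (w := w) (k := 2) (by norm_num) (by norm_num) ?_
    hz3
  have hcop : IsCoprime (3 : ℤ) (1 + 2 * r) :=
    (Irreducible.coprime_iff_not_dvd Int.prime_three.irreducible).2 hr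
  have hcop' : IsCoprime (3 : 𝓞 K) (1 + 2 * r) := by
    have := hcop.map (Int.castRingHom (𝓞 K))
    simpa using this
  have h4 : w ^ 3 = (1 + 2 * r) ^ 3 + 3 * (3 * w * (r * z + (1 + 3 * r)) ^ 3 +
      (1 + 2 * r) * (z * (r * z + (1 + 3 * r))) * w) := by
    have : w = (1 + 2 * r) + z * (r * z + (1 + 3 * r)) := by rw [hw]; ring
    have h5 : w ^ 3 = (1 + 2 * r) ^ 3 + z ^ 3 * (r * z + (1 + 3 * r)) ^ 3 +
      3 * ((1 + 2 * r) * (z * (r * z + (1 + 3 * r))) * w) := by rw [this]; ring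
    rw [h5, hz3]; ring
  -- The constant term `1 + 2r` of `w` is prime to `3`. Cubing `w` turns the rest into multiples of
  -- `3`, since `z³` is one.
  rw [← IsCoprime.pow_right_iff (m := 3) (by norm_num), h4]
  exact (IsCoprime.add_mul_left_right_iff).2 hcop'.pow_right

theorem padicValInt_three_Delta_of_ne {s : ℤ} (hs : ¬ s ≡ 1 [ZMOD 3]) :
    padicValInt 3 (Delta (3 * s)) = 2 := by
  have : Fact (Nat.Prime 3) := ⟨Nat.prime_three⟩
  have h1 : Delta (3 * s) = 3 * (3 * (s ^ 2 + s + 1)) := by rw [Delta]; ring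
  have h2 : ¬ (3 : ℤ) ∣ s ^ 2 + s + 1 := by
    rw [show s ^ 2 + s + 1 = (s - 1) ^ 2 + 3 * s by ring, Int.dvd_add_left (dvd_mul_right _ _)]
    intro h
    have := Int.prime_three.dvd_of_dvd_pow h
    exact hs (by unfold Int.ModEq; omega)
  have h3 : s ^ 2 + s + 1 ≠ 0 := by intro h; rw [h] at h2; simp at h2
  rw [h1, padicValInt.mul (by norm_num) (by simpa using h3),
    padicValInt.mul (by norm_num) h3]
  have h4 : padicValInt 3 3 = 1 := padicValInt_self
  have h5 : padicValInt 3 (s ^ 2 + s + 1) = 0 := padicValInt.eq_zero_of_not_dvd h2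
  omega

theorem padicValInt_three_Delta_of_eq (r : ℤ) : padicValInt 3 (Delta (3 + 9 * r)) = 3 := by
  have : Fact (Nat.Prime 3) := ⟨Nat.prime_three⟩
  have h1 : Delta (3 + 9 * r) = 3 * (3 * (3 * (3 * (r ^ 2 + r) + 1))) := by rw [Delta]; ring
  have h3 : 3 * (r ^ 2 + r) + 1 ≠ 0 := by omega
  have h2 : ¬ (3 : ℤ) ∣ 3 * (r ^ 2 + r) + 1 := by omega
  rw [h1, padicValInt.mul (by norm_num) (by simpa using h3),
    padicValInt.mul (by norm_num) (by simpa using h3), padicValInt.mul (by norm_num) h3]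
  have h4 : padicValInt 3 3 = 1 := padicValInt_self
  have h5 : padicValInt 3 (3 * (r ^ 2 + r) + 1) = 0 := padicValInt.eq_zero_of_not_dvd h2
  omega

theorem padicValInt_three_Delta_of_not_dvd (ht : ¬ 3 ∣ t) : padicValInt 3 (Delta t) = 0 := by
  apply padicValInt.eq_zero_of_not_dvd
  intro h
  apply ht
  have : (3 : ℤ) ∣ t ^ 2 := by
    rw [show t ^ 2 = Delta t - 3 * (t + 3) by rw [Delta]; ring]
    exact dvd_sub h (dvd_mul_right _ _)
  exact Int.prime_three.dvd_of_dvd_pow this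

theorem three_dvd_explicitConductor :
    3 ∣ explicitConductor t ↔ 3 ∣ t ∧ ¬ t ≡ 12 [ZMOD 27] := by
  have h : ¬ 3 ∣ ∏ p ∈ tamePrimes t, p := by
    rw [Nat.prime_three.prime.dvd_finsetProd_iff]
    rintro ⟨p, hp, hd⟩
    have := mem_tamePrimes.1 hp
    exact this.2.1 ((Nat.prime_dvd_prime_iff_eq Nat.prime_three this.1).1 hd).symm
  unfold explicitConductor
  split_ifs with h1
  · simp only [h1, not_false_eq_true, and_self, iff_true]
    exact Dvd.dvd.mul_right (by norm_num) _
  · simp only [h1, iff_false, one_mul]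
    exact h

theorem prime_dvd_explicitConductor {p : ℕ} (hp : p.Prime) (hp3 : p ≠ 3) :
    p ∣ explicitConductor t ↔ ¬ 3 ∣ padicValInt p (Delta t) := by
  have h9 : ¬ p ∣ if 3 ∣ t ∧ ¬ t ≡ 12 [ZMOD 27] then 9 else 1 := by
    split_ifs
    · intro h
      exact hp3 ((Nat.prime_dvd_prime_iff_eq hp Nat.prime_three).1
        (hp.dvd_of_dvd_pow (show p ∣ 3 ^ 2 from h)))
    · exact fun h ↦ hp.one_lt.ne' (Nat.dvd_one.1 h)
  rw [explicitConductor, hp.dvd_mul, or_iff_right h9, hp.prime.dvd_finsetProd_iff]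
  constructor
  · rintro ⟨q, hq, hd⟩
    have h1 := mem_tamePrimes.1 hq
    rw [(Nat.prime_dvd_prime_iff_eq hp h1.1).1 hd]
    exact h1.2.2
  · intro h
    exact ⟨p, mem_tamePrimes.2 ⟨hp, hp3, h⟩, dvd_rfl⟩

theorem exists_pow_three_eq_span_of_dvd_explicitConductor
    (hΘ : Θ ^ 3 - t * Θ ^ 2 - (t + 3) * Θ - 1 = 0) {p : ℕ} (hp : p.Prime)
    (hd : p ∣ explicitConductor t) : ∃ P : Ideal (𝓞 K), P ^ 3 = Ideal.span {(p : 𝓞 K)} := by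
  by_cases hp3 : p = 3
  · subst hp3
    obtain ⟨⟨s, rfl⟩, h12⟩ := three_dvd_explicitConductor.1 hd
    by_cases hs : s ≡ 1 [ZMOD 3]
    · obtain ⟨r, hr⟩ := hs.symm.dvd
      have := exists_pow_three_eq_span_three hΘ (r := r) (by omega) (fun h ↦ h12 (by
        unfold Int.ModEq; omega))
      simpa using this
    · exact exists_pow_three_eq_span_of_Delta hΘ hp (by
        rw [padicValInt_three_Delta_of_ne hs]; norm_num)
  · exact exists_pow_three_eq_span_of_Delta hΘ hp ((prime_dvd_explicitConductor hp hp3).1 hd)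

end Ramification

end SimplestCubic

/-! ### The conductor of `K`. -/

open NumberField IntermediateField

namespace SimplestCubic

theorem isCyclotomicExtension_adjoin_zeta {m : ℕ} (hm : m ≠ 0) :
    IsCyclotomicExtension {m} ℚ (adjoin ℚ {zeta m}) := by
  have : NeZero m := ⟨hm⟩
  have hint : IsIntegral ℚ (zeta m) :=
    ((isPrimitiveRoot_zeta hm).isIntegral (Nat.pos_of_ne_zero hm)).tower_top
  change IsCyclotomicExtension {m} ℚ (adjoin ℚ {zeta m}).toSubalgebra
  rw [adjoin_simple_toSubalgebra_of_isAlgebraic hint.isAlgebraic]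
  exact (isPrimitiveRoot_zeta hm).adjoin_isCyclotomicExtension ℚ

theorem mem_adjoin_of_mem_adjoin_rat {F : IntermediateField ℚ ℂ} {w x : ℂ}
    (h : x ∈ adjoin ℚ {w}) : x ∈ adjoin F {w} := by
  have hle : adjoin ℚ {w} ≤ restrictScalars ℚ (adjoin F {w}) := by
    rw [adjoin_simple_le_iff]
    exact mem_adjoin_simple_self F w
  exact (mem_restrictScalars ℚ).1 (hle h)

section Conductor

variable {t : ℤ} {θ : ℂ}

theorem finrank_adjoin_root (hθ : θ ^ 3 - t * θ ^ 2 - (t + 3) * θ - 1 = 0) :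
    IsIntegral ℚ θ ∧ Module.finrank ℚ (adjoin ℚ {θ}) = 3 := by
  have h := natDegree_minpoly_of_no_root (F := ℚ) hθ (no_rational_root t)
  have hint : IsIntegral ℚ θ := by
    by_contra hcon
    rw [minpoly.eq_zero hcon] at h
    simp at h
  exact ⟨hint, by rw [adjoin.finrank hint, h]⟩

/-- The relation `(p) = P³` persists after extension to `ℚ(ζ_m)`, where ramification forces `p ∣ m`,
or `9 ∣ m` if `p = 3`; these factors are coprime. -/
theorem explicitConductor_dvd {m : ℕ} (hm : m ≠ 0) {K : IntermediateField ℚ ℂ} [NumberField K]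
    {Θ : 𝓞 K} (hΘ : Θ ^ 3 - t * Θ ^ 2 - (t + 3) * Θ - 1 = 0)
    (hK : K ≤ adjoin ℚ {zeta m}) : explicitConductor t ∣ m := by
  have : NeZero m := ⟨hm⟩
  have hcyc := isCyclotomicExtension_adjoin_zeta hm
  have : NumberField (adjoin ℚ {zeta m}) := IsCyclotomicExtension.numberField {m} ℚ _
  have key : ∀ p : ℕ, p.Prime → p ∣ explicitConductor t → (if p = 3 then 9 else p) ∣ m := by
    intro p hp hd
    obtain ⟨P, hP⟩ := exists_pow_three_eq_span_of_dvd_explicitConductor hΘ hp hd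
    refine IsCyclotomicExtension.Rat.dvd_of_pow_three_eq_span (L := adjoin ℚ {zeta m}) hp
      (I := P.map (RingOfIntegers.mapRingHom (inclusion hK : K →+* adjoin ℚ {zeta m}))) ?_
    rw [← Ideal.map_pow, hP, Ideal.map_span, Set.image_singleton, map_natCast]
  have hprod : ∏ p ∈ tamePrimes t, p ∣ m := by
    apply Finset.prod_primes_dvd
    · exact fun p hp ↦ (mem_tamePrimes.1 hp).1.prime
    · intro p hp
      have h1 := mem_tamePrimes.1 hp
      have := key p h1.1 ((prime_dvd_explicitConductor h1.1 h1.2.1).2 h1.2.2)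
      rwa [if_neg h1.2.1] at this
  rw [explicitConductor]
  split_ifs with h
  · refine Nat.Coprime.mul_dvd_of_dvd_of_dvd ?_ ?_ hprod
    · rw [show (9 : ℕ) = 3 ^ 2 by norm_num]
      apply Nat.Coprime.pow_left
      rw [Nat.coprime_prod_right_iff]
      intro p hp
      have h1 := mem_tamePrimes.1 hp
      exact (Nat.coprime_primes Nat.prime_three h1.1).2 (Ne.symm h1.2.1)
    · have := key 3 Nat.prime_three (three_dvd_explicitConductor.2 h)
      rwa [if_pos rfl] at this
  · rwa [one_mul]

theorem conductor_eq (hθ : θ ^ 3 - t * θ ^ 2 - (t + 3) * θ - 1 = 0)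
    {K : IntermediateField ℚ ℂ} [NumberField K] (hK : K = adjoin ℚ {θ}) {Θ : 𝓞 K}
    (hΘ : Θ ^ 3 - t * Θ ^ 2 - (t + 3) * Θ - 1 = 0) : conductor K = explicitConductor t := by
  have hmem : explicitConductor t ∈ {m : ℕ | 0 < m ∧ K ≤ adjoin ℚ {zeta m}} := by
    refine ⟨Nat.pos_of_ne_zero (explicitConductor_ne_zero t), ?_⟩
    rw [hK, adjoin_simple_le_iff]
    exact root_mem_adjoin_explicitConductor hθ
  apply le_antisymm
  · exact Nat.sInf_le hmem
  · apply le_csInf ⟨_, hmem⟩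
    rintro m ⟨hm, hle⟩
    exact Nat.le_of_dvd hm (explicitConductor_dvd hm.ne' hΘ hle)

/-- The only cubic field of conductor dividing `9` is `ℚ(ζ₉ + ζ₉⁻¹)`. -/
theorem tamePrimes_nonempty (hθ : θ ^ 3 - t * θ ^ 2 - (t + 3) * θ - 1 = 0)
    (h9 : adjoin ℚ {θ} ≠ adjoin ℚ {zeta 9 + (zeta 9)⁻¹}) : (tamePrimes t).Nonempty := by
  by_contra hcon
  rw [Finset.not_nonempty_iff_eq_empty] at hcon
  apply h9
  have hz : IsPrimitiveRoot (zeta 9) 9 := isPrimitiveRoot_zeta (by norm_num)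
  have hz0 : zeta 9 ≠ 0 := hz.ne_zero (by norm_num)
  set η := zeta 9 + (zeta 9)⁻¹ with hη
  have hd : explicitConductor t ∣ 9 := by
    rw [explicitConductor, hcon, Finset.prod_empty, mul_one]
    split_ifs <;> norm_num
  have hθ9 : θ ∈ adjoin ℚ {zeta 9} := by
    have h1 := root_mem_adjoin_explicitConductor hθ
    have h2 : adjoin ℚ {zeta (explicitConductor t)} ≤ adjoin ℚ {zeta 9} := by
      rw [adjoin_simple_le_iff]
      exact zeta_mem_adjoin_zeta (by norm_num) hd
    exact h2 h1
  have hmem : θ ∈ adjoin ℚ {η} := by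
    refine root_mem_of_mem_adjoin_quadratic (w := zeta 9) (b := -η) (c := 1) hθ
      (neg_mem (mem_adjoin_simple_self ℚ η)) (one_mem _) ?_ ?_
    · rw [hη]; field_simp; ring
    · exact mem_adjoin_of_mem_adjoin_rat hθ9
  have hroot : η ^ 3 - 3 * η + 1 = 0 := by
    have h1 : zeta 9 ^ 3 = zeta 3 := zeta_pow_div (m := 3) (n := 9) (by norm_num) (by norm_num)
    have h2 := zeta_three_sq
    have h3 : (zeta 9) ^ 6 + zeta 9 ^ 3 + 1 = 0 := by
      rw [show zeta 9 ^ 6 = (zeta 9 ^ 3) ^ 2 by ring, h1]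
      linear_combination h2
    rw [hη]
    field_simp
    linear_combination h3
  set q : Polynomial ℚ := Polynomial.X ^ 3 - 3 * Polynomial.X + 1 with hq
  have hqm : q.Monic := by rw [hq]; monicity!
  have hqd : q.natDegree ≤ 3 := by rw [hq]; compute_degree
  have hq0 : Polynomial.aeval η q = 0 := by
    simpa only [hq, map_add, map_sub, map_mul, map_pow, Polynomial.aeval_X, map_one,
      map_ofNat] using hroot
  have hint : IsIntegral ℚ η := ⟨q, hqm, hq0⟩
  have : FiniteDimensional ℚ (adjoin ℚ {η}) := adjoin.finiteDimensional hint
  -- `ℚ(θ)` has degree `3` and lies in `ℚ(η)`, whose degree is at most `3`.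
  apply eq_of_le_of_finrank_le
  · rw [adjoin_simple_le_iff]; exact hmem
  · rw [(finrank_adjoin_root hθ).2, adjoin.finrank hint]
    exact (Polynomial.natDegree_le_of_dvd (minpoly.dvd ℚ η hq0) hqm.ne_zero).trans hqd

end Conductor

/-! ### Rational cubes and valuations. -/

section Valuations

theorem three_dvd_padicValInt_of_pow_three_eq {p : ℕ} (hp : p.Prime) {r : ℚ} {n : ℤ}
    (hr : r ^ 3 = n) : 3 ∣ padicValInt p n := by
  have : Fact p.Prime := ⟨hp⟩
  have h1 : padicValRat p (r ^ 3) = padicValInt p n := by rw [hr, padicValRat.of_int]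
  by_cases h0 : r = 0
  · have : n = 0 := by
      rw [h0, zero_pow three_ne_zero] at hr
      exact_mod_cast hr.symm
    simp [this]
  · rw [padicValRat.pow] at h1
    omega

theorem exists_mul_pow_three_eq {a b : ℕ} (ha : a ≠ 0) (hb : b ≠ 0)
    (h : ∀ p : ℕ, p.Prime → padicValNat p a ≤ padicValNat p b ∧
      3 ∣ padicValNat p b - padicValNat p a) : ∃ n, n ≠ 0 ∧ a * n ^ 3 = b := by
  have hdvd : a ∣ b := by
    rw [← Nat.factorization_le_iff_dvd ha hb, Finsupp.le_iff]
    intro p _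
    by_cases hp : p.Prime
    · rw [Nat.factorization_def _ hp, Nat.factorization_def _ hp]; exact (h p hp).1
    · simp [Nat.factorization_eq_zero_of_not_prime _ hp]
  obtain ⟨m, rfl⟩ := hdvd
  have hm : m ≠ 0 := right_ne_zero_of_mul hb
  refine ⟨∏ p ∈ m.primeFactors, p ^ (m.factorization p / 3),
    Finset.prod_ne_zero_iff.2 fun p hp ↦ pow_ne_zero _ (Nat.prime_of_mem_primeFactors hp).ne_zero,
    ?_⟩
  congr 1
  rw [← Finset.prod_pow]
  conv_rhs => rw [← Nat.prod_factorization_pow_eq_self hm]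
  refine Finset.prod_congr rfl fun p hp ↦ ?_
  have hpp := Nat.prime_of_mem_primeFactors hp
  have : Fact p.Prime := ⟨hpp⟩
  rw [← pow_mul, Nat.div_mul_cancel]
  have := (h p hpp).2
  rwa [padicValNat.mul ha hm, Nat.add_sub_cancel_left, ← Nat.factorization_def _ hpp] at this

end Valuations

end SimplestCubic

/-! ### From cubes `c Δ_t ^ j` to the valuation conditions. -/

open NumberField IntermediateField

namespace SimplestCubic

variable {t : ℤ}

theorem padicValNat_explicitConductor {p : ℕ} (hp : p.Prime) (hp3 : p ≠ 3) :
    padicValNat p (explicitConductor t) = if p ∣ explicitConductor t then 1 else 0 := by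
  have : Fact p.Prime := ⟨hp⟩
  split_ifs with h
  · have hmem : p ∈ tamePrimes t :=
      mem_tamePrimes.2 ⟨hp, hp3, (prime_dvd_explicitConductor hp hp3).1 h⟩
    have h1 : ¬ p ∣ (if 3 ∣ t ∧ ¬ t ≡ 12 [ZMOD 27] then 9 else 1) := by
      split_ifs
      · intro h
        exact hp3 ((Nat.prime_dvd_prime_iff_eq hp Nat.prime_three).1
          (hp.dvd_of_dvd_pow (show p ∣ 3 ^ 2 from h)))
      · exact fun h ↦ hp.one_lt.ne' (Nat.dvd_one.1 h)
    have h2 : ¬ p ∣ ∏ q ∈ (tamePrimes t).erase p, q := by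
      rw [hp.prime.dvd_finsetProd_iff]
      rintro ⟨q, hq, hd⟩
      rw [Finset.mem_erase] at hq
      exact hq.1 ((Nat.prime_dvd_prime_iff_eq hp (mem_tamePrimes.1 hq.2).1).1 hd).symm
    have h0 : ∏ q ∈ (tamePrimes t).erase p, q ≠ 0 := by
      intro h0; rw [h0] at h2; exact h2 (dvd_zero p)
    rw [explicitConductor, padicValNat.mul (by split_ifs <;> norm_num) (prod_tamePrimes_ne_zero t),
      padicValNat.eq_zero_of_not_dvd h1, ← Finset.mul_prod_erase _ _ hmem,
      padicValNat.mul hp.ne_zero h0, padicValNat_self, padicValNat.eq_zero_of_not_dvd h2]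
  · exact padicValNat.eq_zero_of_not_dvd h

theorem padicValNat_three_explicitConductor :
    padicValNat 3 (explicitConductor t) = if 3 ∣ explicitConductor t then 2 else 0 := by
  have : Fact (Nat.Prime 3) := ⟨Nat.prime_three⟩
  split_ifs with h
  · have h1 : ¬ 3 ∣ ∏ q ∈ tamePrimes t, q := by
      rw [Nat.prime_three.prime.dvd_finsetProd_iff]
      rintro ⟨q, hq, hd⟩
      have hq := mem_tamePrimes.1 hq
      exact hq.2.1 ((Nat.prime_dvd_prime_iff_eq Nat.prime_three hq.1).1 hd).symm
    rw [explicitConductor, if_pos (three_dvd_explicitConductor.1 h),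
      padicValNat.mul (by norm_num) (prod_tamePrimes_ne_zero t),
      padicValNat.eq_zero_of_not_dvd h1, show (9 : ℕ) = 3 ^ 2 by norm_num, padicValNat.prime_pow]
  · exact padicValNat.eq_zero_of_not_dvd h

theorem padicValInt_three_Delta (t : ℤ) :
    (¬ 3 ∣ t ∧ padicValInt 3 (Delta t) = 0) ∨
    ((t ≡ 0 [ZMOD 9] ∨ t ≡ 6 [ZMOD 9]) ∧ padicValInt 3 (Delta t) = 2) ∨
    (t ≡ 3 [ZMOD 9] ∧ padicValInt 3 (Delta t) = 3) := by
  by_cases h3 : 3 ∣ t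
  · obtain ⟨s, rfl⟩ := h3
    by_cases hs : s ≡ 1 [ZMOD 3]
    · obtain ⟨r, hr⟩ := hs.symm.dvd
      have ht : 3 * s = 3 + 9 * r := by omega
      refine Or.inr (Or.inr ⟨by unfold Int.ModEq; omega, ?_⟩)
      rw [ht, padicValInt_three_Delta_of_eq]
    · refine Or.inr (Or.inl ⟨?_, padicValInt_three_Delta_of_ne hs⟩)
      unfold Int.ModEq at hs ⊢; omega
  · exact Or.inl ⟨h3, padicValInt_three_Delta_of_not_dvd h3⟩

/-- The valuation conditions on the primes dividing the conductor, restated in terms of `t`. -/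
theorem valuation_conditions_iff (t : ℤ) :
    ((¬ 3 ∣ explicitConductor t ∧
        ((∀ p : ℕ, p.Prime → p ∣ explicitConductor t → padicValInt p (Delta t) ≡ 1 [MOD 3]) ∨
          (∀ p : ℕ, p.Prime → p ∣ explicitConductor t → padicValInt p (Delta t) ≡ 2 [MOD 3]))) ∨
      (3 ∣ explicitConductor t ∧ padicValInt 3 (Delta t) = 2 ∧
          ∀ p : ℕ, p.Prime → p ≠ 3 → p ∣ explicitConductor t →
            padicValInt p (Delta t) ≡ 1 [MOD 3])) ↔
    ((¬ 3 ∣ t ∨ t ≡ 12 [ZMOD 27]) ∧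
        ((∀ p : ℕ, p.Prime → ¬ padicValInt p (Delta t) ≡ 1 [MOD 3]) ∨
          (∀ p : ℕ, p.Prime → ¬ padicValInt p (Delta t) ≡ 2 [MOD 3]))) ∨
      ((t ≡ 0 [ZMOD 9] ∨ t ≡ 6 [ZMOD 9]) ∧
        ∀ p : ℕ, p.Prime → p ≠ 3 → ¬ padicValInt p (Delta t) ≡ 2 [MOD 3]) := by
  have hc3 := three_dvd_explicitConductor (t := t)
  have hv3 := padicValInt_three_Delta t
  have hp : ∀ p : ℕ, p.Prime → p ≠ 3 →
      (p ∣ explicitConductor t ↔ ¬ 3 ∣ padicValInt p (Delta t)) :=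
    fun p hp hp3 ↦ prime_dvd_explicitConductor hp hp3
  unfold Int.ModEq Nat.ModEq at *
  constructor
  · rintro (⟨h3, h⟩ | ⟨h3, hv, h⟩)
    · left
      refine ⟨by rw [hc3] at h3; tauto, ?_⟩
      -- When `3 ∤ c` the valuation at `3` is `0` or `3`, so letting `p` range over all primes adds
      -- no condition at `3`.
      have h33 : padicValInt 3 (Delta t) % 3 = 0 := by
        rw [hc3] at h3
        rcases hv3 with hv3 | hv3 | hv3
        · omega
        · exact absurd ⟨by omega, by omega⟩ h3
        · omega
      rcases h with h | h
      · right
        intro p hpp hcon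
        by_cases hp3 : p = 3
        · subst hp3; omega
        · have := h p hpp ((hp p hpp hp3).2 (by omega)); omega
      · left
        intro p hpp hcon
        by_cases hp3 : p = 3
        · subst hp3; omega
        · have := h p hpp ((hp p hpp hp3).2 (by omega)); omega
    · right
      refine ⟨by omega, fun p hpp hp3 hcon ↦ ?_⟩
      have := h p hpp hp3 ((hp p hpp hp3).2 (by omega)); omega
  · rintro (⟨h3, h⟩ | ⟨h3, h⟩)
    · left
      have h3' : ¬ 3 ∣ explicitConductor t := by rw [hc3]; tauto
      refine ⟨h3', ?_⟩
      rcases h with h | h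
      · right
        intro p hpp hd
        have h1 := (hp p hpp (by rintro rfl; exact h3' hd)).1 hd
        have h2 := h p hpp
        omega
      · left
        intro p hpp hd
        have h1 := (hp p hpp (by rintro rfl; exact h3' hd)).1 hd
        have h2 := h p hpp
        omega
    · right
      refine ⟨hc3.2 ⟨by omega, by omega⟩, by omega, fun p hpp hp3 hd ↦ ?_⟩
      have h1 := (hp p hpp hp3).1 hd
      have h2 := h p hpp hp3
      omega

/-- At a tame prime `1 + j v_p(Δ_t) ≡ 0 mod 3`. One such prime excludes `3 ∣ j`, and then `j` mod
`3` fixes the class of `v_p` for all of them at once. -/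
theorem valuation_conditions_of_pow_three_eq (hne : (tamePrimes t).Nonempty) {j : ℕ} {r : ℚ}
    (h : r ^ 3 = explicitConductor t * Delta t ^ j) :
    (¬ 3 ∣ explicitConductor t ∧
        ((∀ p : ℕ, p.Prime → p ∣ explicitConductor t → padicValInt p (Delta t) ≡ 1 [MOD 3]) ∨
          (∀ p : ℕ, p.Prime → p ∣ explicitConductor t → padicValInt p (Delta t) ≡ 2 [MOD 3]))) ∨
      (3 ∣ explicitConductor t ∧ padicValInt 3 (Delta t) = 2 ∧
          ∀ p : ℕ, p.Prime → p ≠ 3 → p ∣ explicitConductor t →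
            padicValInt p (Delta t) ≡ 1 [MOD 3]) := by
  have hΔ := (Delta_pos t).ne'
  have hval : ∀ p : ℕ, p.Prime →
      (padicValNat p (explicitConductor t) + j * padicValInt p (Delta t)) % 3 = 0 := by
    intro p hp
    have : Fact p.Prime := ⟨hp⟩
    have hpow : padicValInt p (Delta t ^ j) = j * padicValInt p (Delta t) := by
      rw [padicValInt, Int.natAbs_pow, padicValNat.pow]; rfl
    have h1 : 3 ∣ padicValInt p (explicitConductor t * Delta t ^ j) :=
      three_dvd_padicValInt_of_pow_three_eq hp (r := r) (by rw [h]; push_cast; rfl)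
    rw [padicValInt.mul (by exact_mod_cast explicitConductor_ne_zero t) (pow_ne_zero j hΔ),
      padicValInt.of_nat, hpow] at h1
    exact Nat.mod_eq_zero_of_dvd h1
  have htame : ∀ p : ℕ, p.Prime → p ≠ 3 → p ∣ explicitConductor t →
      (1 + (j % 3) * (padicValInt p (Delta t) % 3)) % 3 = 0 := by
    intro p hp hp3 hd
    have := hval p hp
    rw [padicValNat_explicitConductor hp hp3, if_pos hd] at this
    simpa [Nat.add_mod, Nat.mul_mod] using this
  have hj : j % 3 = 1 ∨ j % 3 = 2 := by
    obtain ⟨p, hp⟩ := hne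
    have h1 := mem_tamePrimes.1 hp
    have h2 := htame p h1.1 h1.2.1 ((prime_dvd_explicitConductor h1.1 h1.2.1).2 h1.2.2)
    have h3 : j % 3 = 0 ∨ j % 3 = 1 ∨ j % 3 = 2 := by omega
    rcases h3 with h3 | h3
    · rw [h3] at h2; omega
    · exact h3
  unfold Nat.ModEq
  by_cases h3 : 3 ∣ explicitConductor t
  · right
    have h4 := hval 3 Nat.prime_three
    rw [padicValNat_three_explicitConductor, if_pos h3, Nat.add_mod, Nat.mul_mod] at h4
    obtain ⟨h3t, -⟩ := three_dvd_explicitConductor.1 h3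
    have hv : padicValInt 3 (Delta t) = 2 := by
      rcases padicValInt_three_Delta t with ⟨h5, -⟩ | ⟨-, h5⟩ | ⟨-, h5⟩
      · exact absurd h3t h5
      · exact h5
      -- The case `t ≡ 3` or `21 mod 27`: here `v_3(c) = 2` and `v_3(Δ_t) = 3`, so no `j` works.
      · rw [h5] at h4; norm_num at h4
    rw [hv] at h4
    refine ⟨h3, hv, fun p hp hp3 hd ↦ ?_⟩
    have h5 := htame p hp hp3 hd
    -- At `3` the condition reads `2 + 2j ≡ 0`, so `j ≡ 2` and every tame valuation is `≡ 1`.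
    rcases hj with hj | hj <;> rw [hj] at h4 h5 <;> omega
  · left
    refine ⟨h3, ?_⟩
    have h4 : ∀ p : ℕ, p.Prime → p ∣ explicitConductor t → p ≠ 3 := by
      rintro p - hd rfl; exact h3 hd
    rcases hj with hj | hj
    · right
      intro p hp hd
      have h5 := htame p hp (h4 p hp hd) hd
      rw [hj] at h5; omega
    · left
      intro p hp hd
      have h5 := htame p hp (h4 p hp hd) hd
      rw [hj] at h5; omega

/-- Take `j = 1` if the tame valuations are `≡ 1` and `j = 2` if they are `≡ 2`. If `3 ∣ c`, then `j
= 1` also matches `v_3(c) = 2 = v_3(Δ_t)`. -/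
theorem exists_mul_pow_three_eq_Delta_pow
    (h : (¬ 3 ∣ explicitConductor t ∧
        ((∀ p : ℕ, p.Prime → p ∣ explicitConductor t → padicValInt p (Delta t) ≡ 1 [MOD 3]) ∨
          (∀ p : ℕ, p.Prime → p ∣ explicitConductor t → padicValInt p (Delta t) ≡ 2 [MOD 3]))) ∨
      (3 ∣ explicitConductor t ∧ padicValInt 3 (Delta t) = 2 ∧
          ∀ p : ℕ, p.Prime → p ≠ 3 → p ∣ explicitConductor t →
            padicValInt p (Delta t) ≡ 1 [MOD 3])) :
    ∃ n j : ℕ, n ≠ 0 ∧ (explicitConductor t * n ^ 3 : ℤ) = Delta t ^ j := by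
  have hΔ0 : (Delta t).natAbs ≠ 0 := Int.natAbs_ne_zero.2 (Delta_pos t).ne'
  have key : ∀ j : ℕ, (∀ p : ℕ, p.Prime → padicValNat p (explicitConductor t) ≤
      j * padicValInt p (Delta t) ∧
      3 ∣ j * padicValInt p (Delta t) - padicValNat p (explicitConductor t)) →
      ∃ n j : ℕ, n ≠ 0 ∧ (explicitConductor t * n ^ 3 : ℤ) = Delta t ^ j := by
    intro j hj
    obtain ⟨n, hn, hn'⟩ := exists_mul_pow_three_eq (explicitConductor_ne_zero t)
      (pow_ne_zero j hΔ0) (fun p hp ↦ by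
        have : Fact p.Prime := ⟨hp⟩
        rw [padicValNat.pow]
        exact hj p hp)
    refine ⟨n, j, hn, ?_⟩
    have h1 : ((Delta t).natAbs : ℤ) = Delta t := Int.natAbs_of_nonneg (Delta_pos t).le
    rw [← h1]
    exact_mod_cast hn'
  have hp' : ∀ p : ℕ, p.Prime → p ≠ 3 →
      (p ∣ explicitConductor t ↔ ¬ 3 ∣ padicValInt p (Delta t)) :=
    fun p hp hp3 ↦ prime_dvd_explicitConductor hp hp3
  have hv3 := padicValInt_three_Delta t
  have hc3 := three_dvd_explicitConductor (t := t)
  unfold Nat.ModEq at h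
  rcases h with ⟨h3, h⟩ | ⟨h3, hv, h⟩
  · have h33 : 3 ∣ padicValInt 3 (Delta t) := by
      rw [hc3] at h3
      unfold Int.ModEq at hv3 h3
      rcases hv3 with hv3 | hv3 | hv3
      · omega
      · exact absurd ⟨by omega, by omega⟩ h3
      · omega
    rcases h with h | h
    · refine key 1 fun p hp ↦ ?_
      by_cases hp3 : p = 3
      · subst hp3
        rw [padicValNat_three_explicitConductor, if_neg h3]; omega
      · rw [padicValNat_explicitConductor hp hp3]
        have h1 := hp' p hp hp3
        have h2 := h p hp
        split_ifs with hd
        · have := h2 hd; omega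
        · have := h1.not.1 hd; omega
    · refine key 2 fun p hp ↦ ?_
      by_cases hp3 : p = 3
      · subst hp3
        rw [padicValNat_three_explicitConductor, if_neg h3]; omega
      · rw [padicValNat_explicitConductor hp hp3]
        have h1 := hp' p hp hp3
        have h2 := h p hp
        split_ifs with hd
        · have := h2 hd; omega
        · have := h1.not.1 hd; omega
  · refine key 1 fun p hp ↦ ?_
    by_cases hp3 : p = 3
    · subst hp3
      rw [padicValNat_three_explicitConductor, if_pos h3, hv]; omega
    · rw [padicValNat_explicitConductor hp hp3]
      have h1 := hp' p hp hp3
      have h2 := h p hp hp3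
      split_ifs with hd
      · have := h2 hd; omega
      · have := h1.not.1 hd; omega

end SimplestCubic

/-! ### The main theorem. -/

/-- Let `K = K_t = ℚ(θ)` with `θ` a root of `f_t`, `t ≥ -1`, and `K ≠ ℚ(ζ₉ + ζ₉⁻¹)`. Then `𝔆_K` is
the unique integral ideal of norm `c_K`, and the three conditions are equivalent. -/
theorem mainTheorem5 (t : ℤ) (ht : -1 ≤ t) (θ : ℂ)
    (hθ : Polynomial.aeval θ (SimplestCubic.shanksPoly t) = 0)
    (K : IntermediateField ℚ ℂ) [NumberField K]
    (hK : K = IntermediateField.adjoin ℚ {θ})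
    (hK9 : K ≠ IntermediateField.adjoin ℚ {SimplestCubic.zeta 9 + (SimplestCubic.zeta 9)⁻¹}) :
    (∀ I : Ideal (NumberField.RingOfIntegers K),
      Ideal.absNorm I = SimplestCubic.conductor K ↔ I = SimplestCubic.conductorIdeal K) ∧
    List.TFAE [
      Submodule.IsPrincipal (SimplestCubic.conductorIdeal K),
      (¬ 3 ∣ SimplestCubic.conductor K ∧
        ((∀ p : ℕ, p.Prime → p ∣ SimplestCubic.conductor K →
            padicValInt p (SimplestCubic.Delta t) ≡ 1 [MOD 3]) ∨
          (∀ p : ℕ, p.Prime → p ∣ SimplestCubic.conductor K →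
            padicValInt p (SimplestCubic.Delta t) ≡ 2 [MOD 3]))) ∨
      (3 ∣ SimplestCubic.conductor K ∧
        padicValInt 3 (SimplestCubic.Delta t) = 2 ∧
          ∀ p : ℕ, p.Prime → p ≠ 3 → p ∣ SimplestCubic.conductor K →
            padicValInt p (SimplestCubic.Delta t) ≡ 1 [MOD 3]),
      ((¬ 3 ∣ t ∨ t ≡ 12 [ZMOD 27]) ∧
        ((∀ p : ℕ, p.Prime → ¬ padicValInt p (SimplestCubic.Delta t) ≡ 1 [MOD 3]) ∨
          (∀ p : ℕ, p.Prime → ¬ padicValInt p (SimplestCubic.Delta t) ≡ 2 [MOD 3]))) ∨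
      ((t ≡ 0 [ZMOD 9] ∨ t ≡ 6 [ZMOD 9]) ∧
        ∀ p : ℕ, p.Prime → p ≠ 3 → ¬ padicValInt p (SimplestCubic.Delta t) ≡ 2 [MOD 3])] := by
  have hθ' : θ ^ 3 - t * θ ^ 2 - (t + 3) * θ - 1 = 0 := by
    rw [← SimplestCubic.aeval_shanksPoly]; exact hθ
  obtain ⟨hint, hfr⟩ := SimplestCubic.finrank_adjoin_root hθ'
  subst hK
  set K := IntermediateField.adjoin ℚ {θ} with hK
  have hg : IntermediateField.AdjoinSimple.gen ℚ θ ^ 3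
      - t * IntermediateField.AdjoinSimple.gen ℚ θ ^ 2
      - (t + 3) * IntermediateField.AdjoinSimple.gen ℚ θ - 1 = 0 := by
    apply Subtype.val_injective
    push_cast
    exact hθ'
  have hgint : IsIntegral ℤ (IntermediateField.AdjoinSimple.gen ℚ θ) := by
    refine ⟨SimplestCubic.shanksPoly t, ?_, ?_⟩
    · unfold SimplestCubic.shanksPoly; monicity!
    · rw [← Polynomial.aeval_def, SimplestCubic.aeval_shanksPoly, hg]
  obtain ⟨σ, hσ, hσ3, hfix⟩ := SimplestCubic.exists_algEquiv
    (IntermediateField.adjoin.powerBasis hint) hfr hg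
  let Θ : NumberField.RingOfIntegers K := ⟨IntermediateField.AdjoinSimple.gen ℚ θ, hgint⟩
  have hΘ : Θ ^ 3 - t * Θ ^ 2 - (t + 3) * Θ - 1 = 0 := by
    apply NumberField.RingOfIntegers.coe_injective
    push_cast
    exact hg
  have hcond : SimplestCubic.conductor K = SimplestCubic.explicitConductor t :=
    SimplestCubic.conductor_eq hθ' hK hΘ
  have hc := SimplestCubic.explicitConductor_ne_zero t
  have hprime : ∀ p : ℕ, p.Prime → p ∣ SimplestCubic.explicitConductor t →
      ∃ P : Ideal (NumberField.RingOfIntegers K),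
        P ^ 3 = Ideal.span {(p : NumberField.RingOfIntegers K)} :=
    fun p hp hd ↦ SimplestCubic.exists_pow_three_eq_span_of_dvd_explicitConductor hΘ hp hd
  have hnorm : ∀ I : Ideal (NumberField.RingOfIntegers K),
      Ideal.absNorm I = SimplestCubic.conductor K ↔ I ^ 3 =
        Ideal.span {(SimplestCubic.explicitConductor t : NumberField.RingOfIntegers K)} := by
    intro I
    rw [hcond]
    exact Ideal.absNorm_eq_iff_pow_three_eq hfr hc hprime
  have hC : SimplestCubic.conductorIdeal K ^ 3 =
      Ideal.span {(SimplestCubic.explicitConductor t : NumberField.RingOfIntegers K)} := by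
    -- An ideal of norm `c` has to exist before the `epsilon` choice is known to have that norm.
    obtain ⟨C, hC⟩ := Ideal.exists_pow_three_eq_span_natCast hc hprime
    exact (hnorm _).1 (Classical.epsilon_spec
      (p := fun I : Ideal (NumberField.RingOfIntegers K) ↦
        Ideal.absNorm I = SimplestCubic.conductor K) ⟨C, (hnorm C).2 hC⟩)
  have hne := SimplestCubic.tamePrimes_nonempty hθ' hK9
  -- Excluding `ℚ(ζ₉ + ζ₉⁻¹)` provides a tame prime, at which the valuation of `Δ_t` is not a
  -- multiple of `3`.
  have hcube : ∀ r : ℚ, r ^ 3 ≠ SimplestCubic.Delta t := by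
    intro r hr
    obtain ⟨p, hp⟩ := hne
    obtain ⟨hpp, -, hv⟩ := SimplestCubic.mem_tamePrimes.1 hp
    exact hv (SimplestCubic.three_dvd_padicValInt_of_pow_three_eq hpp hr)
  refine ⟨fun I ↦ ?_, ?_⟩
  · rw [hnorm, ← hC]
    exact ⟨SimplestCubic.pow_three_injective, fun h ↦ by rw [h]⟩
  rw [hcond]
  tfae_have 1 → 2 := by
    intro h
    obtain ⟨j, r, hr⟩ := SimplestCubic.exists_pow_three_eq_mul_Delta_pow hfr hσ3 hfix hΘ hσ hcube
      hc hC h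
    exact SimplestCubic.valuation_conditions_of_pow_three_eq hne hr
  tfae_have 2 → 1 := by
    intro h
    obtain ⟨n, j, hn, hj⟩ := SimplestCubic.exists_mul_pow_three_eq_Delta_pow h
    exact SimplestCubic.isPrincipal_of_mul_pow_three_eq hΘ hn hj hC
  tfae_have 2 ↔ 3 := SimplestCubic.valuation_conditions_iff t
  tfae_finish
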